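/- Notation: $e(x)=e^{2\pi i x}$; $\tilde\Phi(u)=\int_0^\infty\Phi(x)x^{u-1}\,dx$; complex powers are principal values (with $\arg\in(-\pi,\pi]$, so $\arg=\pi$ for negative reals). Let $\Phi:(0,\infty)\to\mathbb C$ be smooth with $\sup_{x>0}x^{k+\sigma}|\Phi^{(k)}(x)|<\infty$ for all $k\in\mathbb N$, $\sigma>0$ (for instance the restriction to $(0,\infty)$ of a Schwartz function on $\mathbb R$). Let $a\in\mathbb C$ with $\Re(a)>-2$, and let $h_a(x)=|1-x^2|^{a/2}h_1(x)$, where $h_1:\mathbb R\to\mathbb C$ is compactly supported and is smooth on $|x|>1$ up to the boundary points $\pm1$ (i.e. smooth on $|x|\ge1$). Let $c_m^\pm\in\mathbb C$ be the coefficients of the asymptotic expansions of $h_a$ at $\pm1$ from the side $|x|>1$: as $x\to0^-$, $$h_a(\pm(1-x))=|x|^{a/2}\sum_{m=0}^{M}c_m^\pm x^m+O\big(|x|^{\Re(a)/2+M+1}\big)\qquad\text{for every } M\in\mathbb N .$$ For $m\in\mathbb N$, $\tau>0$ and real $x\ne0$ put $$\mathcal A^{\tau,\pm}_{h_a,m}(\Phi)(x)=\frac1{2\pi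 i}\int_{\Re u=\tau}\tilde\Phi(u)\,c_m^\pm\!\left(\tfrac u2\right)\Gamma\!\left(m+1+\tfrac{a+u}2\right)x^{-u/2}\,du,$$ $$c_m^\pm\!\left(\tfrac u2\right)=\left(\tfrac i{2\pi}\right)^{1+m+\frac{u+a}2}2^{u/2}\sum_{j+k=m}\frac{c_k^\pm}{(-2)^j}\binom{u/2}{j}.$$ Then for all $M\in\mathbb Z_{\ge0}$, all $\tau,\tau_1>0$, all $C>0$ and all $D\in\mathbb R\setminus\{0\}$, $$\int_{|x|>1}h_a(x)\,\Phi\!\left(\tfrac{C}{\sqrt{x^2-1}}\right)e(xD)\,dx=\sum_{\pm}\sum_{m=0}^{M}\frac{e(\pm D)(-1)^m\mathcal A^{\tau,\pm}_{h_a,m}(\Phi)(\pm C^2D)}{(\pm D)^{m+1+\frac a2}}+O\!\left(|C^2D|^{-\tau_1}|D|^{-(M+2+\frac{\Re(a)}2)}\right),$$ where all integrals (including $\tilde\Phi(u)$ for $\Re(u)>0$) converge absolutely and the implied constant depends only on $h_1,\Phi,M,\tau_1$ and $a$; in particular it does not depend on $C$, $D$ or $\tau$. Moreover, one can take $\tau_1=0$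 if $\tilde\Phi$ has at most a simple pole at $u=0$, in the sense that for some $\varepsilon>0$ it continues meromorphically to $\Re(u)>-\varepsilon$ with no singularity except at most a simple pole at $u=0$, and $u\tilde\Phi(u)$ decays faster than any power of $|u|$, uniformly in $-\varepsilon<\Re(u)\le1$. -/

import Mathlib

open Filter Topology MeasureTheory Asymptotics
open scoped ContDiff

noncomputable section

namespace SingularFourier

/-- The additive character `e(x) = exp(2πix)`. -/
def e (x : ℝ) : ℂ := Complex.exp (2 * Real.pi * Complex.I * x)

/-- `f(x) ~ |x|^β ∑ c_m x^m` along the filter `l` (a system of punctured, possibly one-sided,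
neighbourhoods of `0`): for every `M`,
`f(x) = |x|^β ∑_{m ≤ M} c_m x^m + O(|x|^{Re β + M + 1})`. -/
def HasAsympExpansion (l : Filter ℝ) (f : ℝ → ℂ) (β : ℂ) (c : ℕ → ℂ) : Prop :=
  ∀ M : ℕ,
    (fun x : ℝ => f x - ((|x| : ℝ) : ℂ) ^ β * ∑ m ∈ Finset.range (M + 1), c m * (x : ℂ) ^ m)
      =O[l] fun x : ℝ => |x| ^ (β.re + M + 1)

/-- The Schwartz-type condition for functions on the half-line `x > 0`: `Φ` is smooth there, `Φ` and
all its derivatives decay faster than any polynomial at `∞`, and at `0` the `k`-th derivative is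
`O(x^{-k-σ})` for every `σ > 0`, so that the Mellin transform is holomorphic and rapidly
decreasing in `Re u > 0`. Restrictions of Schwartz functions on `ℝ` have this property. -/
def IsHalfLineSchwartz (Φ : ℝ → ℂ) : Prop :=
  ContDiffOn ℝ ∞ Φ (Set.Ioi 0) ∧
    ∀ (k : ℕ) (σ : ℝ), 0 < σ → ∃ K : ℝ, ∀ x : ℝ, 0 < x →
      x ^ ((k : ℝ) + σ) * ‖iteratedDeriv k Φ x‖ ≤ K

/-- The Mellin transform of `Φ` continues meromorphically to some half-plane `Re u > -ε`, where its
only possible singularity is an at most simple pole at `u = 0`, and it decreases there faster than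
any polynomial in vertical directions. (`G u` is the continuation of `u · mellin Φ u`.) -/
def MellinAtMostSimplePole (Φ : ℝ → ℂ) : Prop :=
  ∃ (ε : ℝ) (G : ℂ → ℂ), 0 < ε ∧
    DifferentiableOn ℂ G {u : ℂ | -ε < u.re} ∧
    (∀ u : ℂ, 0 < u.re → G u = u * mellin Φ u) ∧
    ∀ N : ℕ, ∃ K : ℝ, ∀ u : ℂ, -ε < u.re → u.re ≤ 1 → ‖u‖ ^ N * ‖G u‖ ≤ K

/-- The coefficient function
`c_m(v) = (i/2π)^{1+m+v+a/2} 2^v ∑_{j+k=m} c_k (-2)^{-j} binom(v, j)`. -/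
def coeff (a : ℂ) (c : ℕ → ℂ) (m : ℕ) (v : ℂ) : ℂ :=
  (Complex.I / (2 * Real.pi)) ^ (1 + (m : ℂ) + v + a / 2) * (2 : ℂ) ^ v *
    ∑ p ∈ Finset.HasAntidiagonal.antidiagonal m, c p.2 / (-2) ^ p.1 * Ring.choose v p.1

/-- The integrand `Φ̃(u) c_m(u/2) Γ(m+1+(a+u)/2) x^{-u/2}`; powers are principal values. -/
def transformIntegrand (a : ℂ) (c : ℕ → ℂ) (m : ℕ) (Φ : ℝ → ℂ) (x : ℝ) (u : ℂ) : ℂ :=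
  mellin Φ u * coeff a c m (u / 2) * Complex.Gamma ((m : ℂ) + 1 + (a + u) / 2) *
    (x : ℂ) ^ (-(u / 2))

/-- `(1/2πi) ∫_{Re u = τ} Φ̃(u) c_m(u/2) Γ(m+1+(a+u)/2) x^{-u/2} du`, with `u = τ + it`,
`du = i dt`. -/
def transform (a : ℂ) (c : ℕ → ℂ) (m : ℕ) (τ : ℝ) (Φ : ℝ → ℂ) (x : ℝ) : ℂ :=
  1 / (2 * Real.pi * Complex.I) *
    ∫ t : ℝ, transformIntegrand a c m Φ x ((τ : ℂ) + t * Complex.I) * Complex.I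

end SingularFourier

end

open SingularFourier

/-!
Put `|x| = 1 + y` and let `s = ±1` be the sign of `x`, `d = sD`. Then `h(s(1+y)) = y^{a/2} g_s(y)`
with `g_s` smooth on `[0, ∞)` and compactly supported, and Mellin inversion turns the left-hand side
into the integral over `Re u = τ` of `Φ̃(u) C^{-u}/(2πi)` against the Fourier integrals
`e(d) ∫₀^∞ y^{(a+u)/2} g_s(y) (2+y)^{u/2} e(dy) dy` (`integral_side_eq`). Taylor expansion of
`g_s(y) (2+y)^{u/2}` at `y = 0`, combined with `∫₀^∞ y^β e^{-zy} dy = Γ(β+1) z^{-(β+1)}` at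
`z = -2πid`, produces the integrands of the transforms; `transformIntegrand_eq` matches the branches
of the powers, and `sideJet_zero_eq` identifies the Taylor coefficients of `g_s` with the `c_m^±`.

What remains is the remainder of a Watson-type lemma on the boundary of the half-plane `Re z > 0`,
with constants growing at most polynomially in `u`, since `Φ̃` only decreases faster than
polynomials. Rotating the contour would cost a factor exponential in `|Im u|`. Instead, `y^β` times
the Taylor remainder of order `n` is a symbol of order `ρ = Re β + n` on the whole half-line, and
the Laplace transform of a symbol is `O(|z|^{-(ρ+1)})` uniformly in `Re z > 0`
(`norm_integral_symbol_mul_exp_le`), so one may let `z` tend to the imaginary axis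
(`norm_laplaceRem_le`). The bound holds for all `d ≠ 0`, small or large. It also yields the
convergence of the transforms, because each of their integrands is a difference of two consecutive
remainders (`edgeRem_sub_succ`), so that no separate estimate of `Γ` on vertical lines is needed.

The remainder is holomorphic in `u`, and along `Re u = σ` the factor `C^{-u}` and the bound combine
to `|C²D|^{-σ/2} |D|^{-(M+2+Re a/2)}`. Shifting the line of integration to `σ = 2τ₁` gives the
theorem for `τ₁ > 0` and the independence of `τ`. For `τ₁ = 0` one shifts to a small `σ = δ` when
`C²|D| ≥ 1`, and across the simple pole at `0` to `σ = -δ` otherwise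
(`norm_integral_div_le_of_shift`).
-/

noncomputable section

namespace SingularFourier

/-! ### Holomorphic parameter integrals and contour shifts -/

/-- An integral depending on a complex parameter is differentiable at `u₀` if the integrand is
holomorphic in the parameter and dominated on a ball; no bound on the derivative is needed because
Cauchy's estimate provides one. -/
lemma differentiableAt_integral_of_dominated {α : Type*} [MeasurableSpace α] {μ : Measure α}
    {F : ℂ → α → ℂ} {u₀ : ℂ} {r : ℝ} (hr : 0 < r) {bound : α → ℝ} (hb : Integrable bound μ)
    (hmeas : ∀ u ∈ Metric.ball u₀ r, AEStronglyMeasurable (F u) μ)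
    (hF : ∀ᵐ y ∂μ, DifferentiableOn ℂ (fun u => F u y) (Metric.ball u₀ r))
    (hbd : ∀ᵐ y ∂μ, ∀ u ∈ Metric.ball u₀ r, ‖F u y‖ ≤ bound y) :
    DifferentiableAt ℂ (fun u => ∫ y, F u y ∂μ) u₀ := by
  have hball : Metric.ball u₀ r ∈ 𝓝 u₀ := Metric.ball_mem_nhds _ hr
  have hsub : Metric.ball u₀ (r / 2) ∈ 𝓝 u₀ := Metric.ball_mem_nhds _ (by positivity)
  have hdiff : ∀ᵐ y ∂μ, ∀ u ∈ Metric.ball u₀ (r / 2),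
      HasDerivAt (fun u => F u y) (deriv (fun u => F u y) u) u := by
    filter_upwards [hF] with y hy u hu
    exact (hy.differentiableAt (Metric.isOpen_ball.mem_nhds
      (Metric.ball_subset_ball (by linarith) hu))).hasDerivAt
  have hmeas' : AEStronglyMeasurable (fun y => deriv (fun u => F u y) u₀) μ := by
    let q : ℕ → ℂ := fun n => ((r / (n + 2) : ℝ) : ℂ)
    have hq0 : Tendsto q atTop (𝓝 0) := by
      have h1 : Tendsto (fun n : ℕ => r / ((n : ℝ) + 2)) atTop (𝓝 0) :=
        tendsto_const_nhds.div_atTop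
          (tendsto_atTop_add_const_right _ _ tendsto_natCast_atTop_atTop)
      simpa [q, Function.comp_def] using
        (Complex.continuous_ofReal.tendsto (0 : ℝ)).comp h1
    have hqne : ∀ n, q n ≠ 0 := fun n => by
      simp only [q, ne_eq, Complex.ofReal_eq_zero]; positivity
    have hqball : ∀ n, u₀ + q n ∈ Metric.ball u₀ r := fun n => by
      rw [Metric.mem_ball, dist_eq_norm, add_sub_cancel_left, Complex.norm_real, Real.norm_eq_abs,
        abs_of_pos (by positivity)]
      exact div_lt_self hr (by have : (0 : ℝ) ≤ n := n.cast_nonneg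
                               linarith)
    refine aestronglyMeasurable_of_tendsto_ae atTop
      (f := fun n y => (q n)⁻¹ • (F (u₀ + q n) y - F u₀ y)) (fun n => ?_) ?_
    · exact ((hmeas _ (hqball n)).sub (hmeas _ (Metric.mem_ball_self hr))).const_smul (q n)⁻¹
    · filter_upwards [hdiff] with y hy
      have := (hy u₀ (Metric.mem_ball_self (by positivity))).tendsto_slope_zero
      exact this.comp (tendsto_nhdsWithin_iff.2 ⟨hq0, .of_forall hqne⟩)
  refine (hasDerivAt_integral_of_dominated_loc_of_deriv_le (bound := fun y => bound y / (r / 4))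
    hsub ?_ ?_ hmeas' ?_ (hb.div_const _) hdiff).2.differentiableAt
  · filter_upwards [hball] with u hu using hmeas u hu
  · refine hb.mono' (hmeas _ (Metric.mem_ball_self hr)) ?_
    filter_upwards [hbd] with y hy using hy _ (Metric.mem_ball_self hr)
  · filter_upwards [hF, hbd] with y hy hy' u hu
    have hsub : Metric.closedBall u (r / 4) ⊆ Metric.ball u₀ r := by
      intro v hv
      rw [Metric.mem_closedBall] at hv
      rw [Metric.mem_ball] at hu ⊢
      linarith [dist_triangle v u u₀]
    refine Complex.norm_deriv_le_of_forall_mem_sphere_norm_le (by positivity) ?_ ?_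
    · refine DifferentiableOn.diffContOnCl ?_
      rw [closure_ball _ (by positivity)]
      exact hy.mono hsub
    · intro v hv
      exact hy' v (hsub (Metric.sphere_subset_closedBall hv))

/-- Euler's integral `∫₀^∞ y^β e^{-zy} dy = Γ(β+1) z^{-(β+1)}` for complex `z` in the right
half-plane, obtained from real `z` by the identity theorem. -/
lemma integral_cpow_mul_exp_neg_mul {β z : ℂ} (hβ : -1 < β.re) (hz : 0 < z.re) :
    ∫ y : ℝ in Set.Ioi 0, (y : ℂ) ^ β * Complex.exp (-(z * y)) =
      Complex.Gamma (β + 1) * z ^ (-(β + 1)) := by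
  have hint : ∀ b : ℝ, 0 < b →
      IntegrableOn (fun y : ℝ => y ^ β.re * Real.exp (-b * y)) (Set.Ioi 0) := fun b hb => by
    simpa using integrableOn_rpow_mul_exp_neg_mul_rpow hβ one_pos hb (p := 1)
  have hD : DifferentiableOn ℂ
      (fun z : ℂ => ∫ y : ℝ in Set.Ioi 0, (y : ℂ) ^ β * Complex.exp (-(z * y)))
      {z : ℂ | 0 < z.re} := by
    intro z₀ hz₀
    refine DifferentiableAt.differentiableWithinAt ?_
    have hz₀' : 0 < z₀.re := hz₀
    refine differentiableAt_integral_of_dominated (r := z₀.re / 2) (by positivity)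
      (hint (z₀.re / 2) (by positivity)) (fun u _ => ?_) ?_ ?_
    · refine ContinuousOn.aestronglyMeasurable ?_ measurableSet_Ioi
      refine ContinuousOn.mul (fun y hy => ?_) (by fun_prop)
      exact (Complex.continuousAt_ofReal_cpow_const _ _ (Or.inr (ne_of_gt hy))).continuousWithinAt
    · exact .of_forall fun y => by fun_prop
    · filter_upwards [ae_restrict_mem measurableSet_Ioi] with y hy u hu
      have hy' : 0 < y := hy
      rw [norm_mul, Complex.norm_cpow_eq_rpow_re_of_pos hy', Complex.norm_exp]
      refine mul_le_mul_of_nonneg_left (Real.exp_le_exp.2 ?_) (by positivity)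
      have h1 : |(u - z₀).re| < z₀.re / 2 :=
        (Complex.abs_re_le_norm _).trans_lt (by rwa [Metric.mem_ball, dist_eq_norm] at hu)
      have h2 : z₀.re / 2 ≤ u.re := by
        rw [Complex.sub_re, abs_lt] at h1; linarith [h1.1]
      simp only [Complex.neg_re, Complex.mul_re, Complex.ofReal_re, Complex.ofReal_im, mul_zero,
        sub_zero]
      nlinarith
  have hD2 : DifferentiableOn ℂ (fun z : ℂ => Complex.Gamma (β + 1) * z ^ (-(β + 1)))
      {z : ℂ | 0 < z.re} := by
    intro z₀ hz₀
    have hz₀' : 0 < z₀.re := hz₀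
    exact ((differentiableAt_id.cpow_const (Or.inl hz₀')).const_mul _).differentiableWithinAt
  have hopen : IsOpen {z : ℂ | 0 < z.re} := isOpen_lt continuous_const Complex.continuous_re
  have hconn : IsPreconnected {z : ℂ | 0 < z.re} :=
    (convex_halfSpace_re_gt 0).isPreconnected
  refine (hD.analyticOnNhd hopen).eqOn_of_preconnected_of_frequently_eq
    (hD2.analyticOnNhd hopen) hconn (z₀ := 1) (by simp) ?_ hz
  let q : ℕ → ℂ := fun n => ((1 + 1 / ((n : ℝ) + 1) : ℝ) : ℂ)
  have hq : Tendsto q atTop (𝓝[≠] 1) := by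
    refine tendsto_nhdsWithin_iff.2 ⟨?_, .of_forall fun n => ?_⟩
    · have := (Complex.continuous_ofReal.tendsto (1 + 0 : ℝ)).comp
        ((tendsto_const_nhds (x := (1 : ℝ))).add
          (tendsto_one_div_add_atTop_nhds_zero_nat (𝕜 := ℝ)))
      simpa [q, Function.comp_def] using this
    · simp only [q, Set.mem_compl_iff, Set.mem_singleton_iff]
      intro h
      have h' : (1 + 1 / ((n : ℝ) + 1) : ℝ) = 1 := by exact_mod_cast h
      have : 0 < 1 / ((n : ℝ) + 1) := by positivity
      linarith
  refine hq.frequently (Frequently.of_forall fun n => ?_)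
  have hpos : 0 < (1 + 1 / ((n : ℝ) + 1) : ℝ) := by positivity
  have := Complex.integral_cpow_mul_exp_neg_mul_Ioi (a := β + 1) (by simp; linarith) hpos
  simp only [add_sub_cancel_right] at this
  simp only [q]
  rw [this, mul_comm, Complex.cpow_neg, one_div, Complex.inv_cpow]
  rw [Complex.arg_ofReal_of_nonneg hpos.le]
  exact Real.pi_pos.ne

/-- Contour shift between two vertical lines for a function which is holomorphic near the closed
strip between them and decreases quadratically there. -/
lemma integral_vertical_eq {F : ℂ → ℂ} {σ₁ σ₂ K : ℝ}
    (hF : ∀ u : ℂ, σ₁ ≤ u.re → u.re ≤ σ₂ → DifferentiableAt ℂ F u)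
    (hK : ∀ u : ℂ, σ₁ ≤ u.re → u.re ≤ σ₂ → (1 + u.im ^ 2) * ‖F u‖ ≤ K) (h12 : σ₁ ≤ σ₂) :
    ∫ t : ℝ, F (σ₁ + t * Complex.I) = ∫ t : ℝ, F (σ₂ + t * Complex.I) := by
  have hbd : ∀ u : ℂ, σ₁ ≤ u.re → u.re ≤ σ₂ → ‖F u‖ ≤ K * (1 + u.im ^ 2)⁻¹ := by
    intro u h1 h2
    rw [← div_eq_mul_inv, le_div_iff₀' (by positivity)]
    exact hK u h1 h2
  have hint : ∀ σ : ℝ, σ₁ ≤ σ → σ ≤ σ₂ → Integrable (fun t : ℝ => F (σ + t * Complex.I)) := by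
    intro σ h1 h2
    refine (integrable_inv_one_add_sq.const_mul K).mono' ?_ (.of_forall fun t => ?_)
    · refine Continuous.aestronglyMeasurable (continuous_iff_continuousAt.2 fun t => ?_)
      have := (hF (σ + t * Complex.I) (by simpa using h1) (by simpa using h2)).continuousAt
      exact ContinuousAt.comp (f := fun t : ℝ => (σ : ℂ) + t * Complex.I) this
        (by fun_prop)
    · simpa using hbd (σ + t * Complex.I) (by simpa using h1) (by simpa using h2)
  have hlim : ∀ σ : ℝ, σ₁ ≤ σ → σ ≤ σ₂ → Tendsto (fun T : ℝ =>
      ∫ t in (-T)..T, F (σ + t * Complex.I)) atTop (𝓝 (∫ t : ℝ, F (σ + t * Complex.I))) :=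
    fun σ h1 h2 => intervalIntegral_tendsto_integral (hint σ h1 h2)
      tendsto_neg_atTop_atBot tendsto_id
  have hhor : ∀ s : ℝ, |s| = 1 → Tendsto (fun T : ℝ =>
      ∫ x in σ₁..σ₂, F (x + (s * T : ℝ) * Complex.I)) atTop (𝓝 0) := by
    intro s hs
    have hb : ∀ T : ℝ, ‖∫ x in σ₁..σ₂, F (x + (s * T : ℝ) * Complex.I)‖ ≤
        K * (1 + T ^ 2)⁻¹ * |σ₂ - σ₁| := fun T => by
      refine intervalIntegral.norm_integral_le_of_norm_le_const fun x hx => ?_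
      rw [Set.uIoc_of_le h12] at hx
      have := hbd (x + (s * T : ℝ) * Complex.I) (by simpa using hx.1.le) (by simpa using hx.2)
      have h2 : (s * T) ^ 2 = T ^ 2 := by rw [mul_pow, ← sq_abs s, hs]; ring
      simp only [Complex.add_im, Complex.ofReal_im, Complex.mul_im, Complex.I_re,
        Complex.I_im, Complex.ofReal_re, mul_zero, mul_one, zero_add, add_zero, h2] at this
      exact this
    refine squeeze_zero_norm hb ?_
    have h3 : Tendsto (fun T : ℝ => (1 + T ^ 2)⁻¹) atTop (𝓝 0) :=
      tendsto_inv_atTop_zero.comp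
        (tendsto_atTop_add_const_left _ _ (tendsto_pow_atTop two_ne_zero))
    simpa using (h3.const_mul K).mul_const |σ₂ - σ₁|
  have hrect : ∀ T : ℝ, (∫ x in σ₁..σ₂, F (x + ((-1) * T : ℝ) * Complex.I)) -
      (∫ x in σ₁..σ₂, F (x + (1 * T : ℝ) * Complex.I)) +
      Complex.I • (∫ t in (-T)..T, F (σ₂ + t * Complex.I)) -
      Complex.I • (∫ t in (-T)..T, F (σ₁ + t * Complex.I)) = 0 := fun T => by
    have := Complex.integral_boundary_rect_eq_zero_of_differentiableOn F
      (σ₁ + (-T : ℝ) * Complex.I) (σ₂ + T * Complex.I) (fun u hu => ?_)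
    · simpa using this
    · rw [Complex.mem_reProdIm] at hu
      have h1 := hu.1
      simp only [Complex.add_re, Complex.ofReal_re, Complex.mul_re, Complex.I_re, mul_zero,
        Complex.ofReal_im, Complex.I_im, mul_one, sub_self, add_zero] at h1
      rw [Set.uIcc_of_le h12] at h1
      exact (hF u h1.1 h1.2).differentiableWithinAt
  have hL := (((hhor (-1) (by simp)).sub (hhor 1 (by simp))).add
    ((hlim σ₂ h12 le_rfl).const_smul Complex.I)).sub ((hlim σ₁ le_rfl h12).const_smul Complex.I)
  have h0 := tendsto_nhds_unique hL (by simpa only [hrect] using tendsto_const_nhds)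
  simp only [sub_self, zero_add, smul_eq_mul, ← mul_sub] at h0
  exact (sub_eq_zero.1 ((mul_eq_zero.1 h0).resolve_left Complex.I_ne_zero)).symm

/-! ### Laplace integrals of symbols -/

lemma norm_exp_neg_mul (z : ℂ) (y : ℝ) :
    ‖Complex.exp (-(z * y))‖ = Real.exp (-z.re * y) := by
  rw [Complex.norm_exp]; simp

lemma integrableOn_Ioi_rpow_mul_exp_neg (p : ℝ) {A b : ℝ} (hA : 0 < A) (hb : 0 < b) :
    IntegrableOn (fun y : ℝ => y ^ p * Real.exp (-b * y)) (Set.Ioi A) := by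
  refine integrable_of_isBigO_exp_neg (b := b / 2) (by positivity) ?_ ?_
  · refine ContinuousOn.mul (fun y hy => ?_) (by fun_prop)
    exact (Real.continuousAt_rpow_const _ _
      (Or.inl (hA.trans_le hy).ne')).continuousWithinAt
  · have h := (isLittleO_rpow_exp_pos_mul_atTop p (half_pos hb)).isBigO.mul
      (isBigO_refl (fun y : ℝ => Real.exp (-b * y)) atTop)
    refine h.congr_right fun y => ?_
    rw [← Real.exp_add]; ring_nf

/-- If `f` is a symbol of order `ρ > -1` on the half-line, i.e. `|f^{(j)}(y)| ≤ B y^{ρ-j}`, then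
its Laplace transform is `O(B |z|^{-(ρ+1)})`, uniformly in the right half-plane. Here `f j` is the
`j`-th derivative. The range `y ≤ 1/|z|` is estimated trivially, and on the rest one integrates by
parts until the integrand decays fast enough. -/
lemma norm_integral_symbol_mul_exp_le {f : ℕ → ℝ → ℂ} {ρ B : ℝ} {K : ℕ}
    (hf : ∀ j, ∀ y : ℝ, 0 < y → HasDerivAt (f j) (f (j + 1) y) y)
    (hB : ∀ j ≤ K, ∀ y : ℝ, 0 < y → ‖f j y‖ ≤ B * y ^ (ρ - j))
    (hρ : 0 < ρ + 1) (hK : ρ + 2 ≤ K) {z : ℂ} (hz : 0 < z.re) :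
    ‖∫ y : ℝ in Set.Ioi 0, f 0 y * Complex.exp (-(z * y))‖ ≤
      B * (1 / (ρ + 1) + K + 1) * ‖z‖ ^ (-(ρ + 1)) := by
  have hB0 : 0 ≤ B := by
    have := (norm_nonneg _).trans (hB 0 (Nat.zero_le _) 1 one_pos)
    simpa using this
  have hz0 : z ≠ 0 := fun h => by simp [h] at hz
  have hcont : ∀ j, ContinuousOn (f j) (Set.Ioi 0) := fun j y hy =>
    (hf j y hy).continuousAt.continuousWithinAt
  have hnorm : ∀ j ≤ K, ∀ y : ℝ, 0 < y → ‖f j y * Complex.exp (-(z * y))‖ ≤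
      B * (y ^ (ρ - j) * Real.exp (-z.re * y)) := fun j hj y hy => by
    rw [norm_mul, norm_exp_neg_mul, ← mul_assoc]
    exact mul_le_mul_of_nonneg_right (hB j hj y hy) (Real.exp_nonneg _)
  have hnorm' : ∀ j ≤ K, ∀ y : ℝ, 0 < y → ‖f j y * Complex.exp (-(z * y))‖ ≤
      B * y ^ (ρ - j) := fun j hj y hy => by
    refine (hnorm j hj y hy).trans (mul_le_mul_of_nonneg_left ?_ hB0)
    refine mul_le_of_le_one_right (by positivity) (Real.exp_le_one_iff.2 ?_)
    nlinarith
  have hmeas : ∀ j, ∀ a : ℝ, 0 ≤ a → AEStronglyMeasurable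
      (fun y : ℝ => f j y * Complex.exp (-(z * y))) (volume.restrict (Set.Ioi a)) :=
    fun j a ha => (((hcont j).mono (Set.Ioi_subset_Ioi ha)).mul
      (by fun_prop)).aestronglyMeasurable measurableSet_Ioi
  set A : ℝ := ‖z‖⁻¹ with hAdef
  have hA : 0 < A := inv_pos.2 (norm_pos_iff.2 hz0)
  have hint : ∀ j ≤ K, IntegrableOn (fun y : ℝ => f j y * Complex.exp (-(z * y))) (Set.Ioi A) := by
    intro j hj
    refine ((integrableOn_Ioi_rpow_mul_exp_neg (ρ - j) hA hz).const_mul B).mono'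
      (hmeas j A hA.le) ?_
    filter_upwards [ae_restrict_mem measurableSet_Ioi] with y hy
    exact hnorm j hj y (hA.trans hy)
  have htail : ∀ i ≤ K, ‖∫ y : ℝ in Set.Ioi A, f (K - i) y * Complex.exp (-(z * y))‖ ≤
      B * (i + 1) * A ^ (ρ + 1 - (K - i : ℕ)) := by
    intro i
    induction i with
    | zero =>
      intro _
      simp only [Nat.sub_zero, CharP.cast_eq_zero, zero_add, mul_one]
      calc _ ≤ ∫ y : ℝ in Set.Ioi A, B * y ^ (ρ - K) := by
            refine norm_integral_le_of_norm_le
              ((integrableOn_Ioi_rpow_of_lt (by linarith) hA).const_mul B) ?_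
            filter_upwards [ae_restrict_mem measurableSet_Ioi] with y hy
            exact hnorm' K le_rfl y (hA.trans hy)
        _ = B * (A ^ (ρ + 1 - K) * (1 / (K - ρ - 1))) := by
            rw [integral_const_mul, integral_Ioi_rpow_of_lt (by linarith) hA,
              show ρ - K + 1 = ρ + 1 - K by ring, neg_div, ← div_neg]
            ring
        _ ≤ B * (A ^ (ρ + 1 - K) * 1) := by
            gcongr
            rw [div_le_one (by linarith)]; linarith
        _ = _ := by rw [mul_one]
    | succ i ih =>
      intro hi
      have ih := ih (by omega)
      set j := K - (i + 1) with hj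
      have hj1 : K - i = j + 1 := by omega
      rw [hj1] at ih
      have hjK : j ≤ K := by omega
      have hjK1 : j + 1 ≤ K := by omega
      have hv : ∀ y : ℝ, HasDerivAt (fun y : ℝ => -z⁻¹ * Complex.exp (-(z * y)))
          (Complex.exp (-(z * y))) y := fun y => by
        have h1 : HasDerivAt (fun y : ℝ => -(z * (y : ℂ))) (-(z * 1)) y :=
          ((Complex.ofRealCLM.hasDerivAt (x := y)).const_mul z).neg
        refine (h1.cexp.const_mul (-z⁻¹)).congr_deriv ?_
        rw [mul_one, neg_mul, mul_neg, mul_neg, neg_neg, mul_left_comm, inv_mul_cancel₀ hz0, mul_one]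
      have hibp := integral_Ioi_mul_deriv_eq_deriv_mul (a := A) (u := f j) (u' := f (j + 1))
        (v := fun y : ℝ => -z⁻¹ * Complex.exp (-(z * y)))
        (v' := fun y : ℝ => Complex.exp (-(z * y)))
        (a' := f j A * (-z⁻¹ * Complex.exp (-(z * A)))) (b' := 0)
        (fun y hy => hf j y (hA.trans hy)) (fun y _ => hv y) (hint j hjK)
        (by
          have := (hint (j + 1) hjK1).const_mul (-z⁻¹)
          refine this.congr (.of_forall fun y => ?_)
          simp only [Pi.mul_apply]; ring)
        (by
          have h1 : ContinuousAt (f j * fun y : ℝ => -z⁻¹ * Complex.exp (-(z * y))) A :=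
            (hf j A hA).continuousAt.mul (hv A).continuousAt
          exact h1.tendsto.mono_left nhdsWithin_le_nhds)
        (by
          have h0 := (tendsto_rpow_mul_exp_neg_mul_atTop_nhds_zero (ρ - j) z.re hz).const_mul
            (‖z⁻¹‖ * B)
          rw [mul_zero] at h0
          refine squeeze_zero_norm' ?_ h0
          filter_upwards [eventually_gt_atTop 0] with y hy
          have := hnorm j hjK y hy
          calc _ = ‖z⁻¹‖ * ‖f j y * Complex.exp (-(z * y))‖ := by
                simp only [Pi.mul_apply, norm_mul, norm_neg]; ring
            _ ≤ ‖z⁻¹‖ * (B * (y ^ (ρ - j) * Real.exp (-z.re * y))) := by gcongr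
            _ = _ := by ring)
      rw [hibp]
      have e1 : ∫ y : ℝ in Set.Ioi A, f (j + 1) y * (-z⁻¹ * Complex.exp (-(z * y))) =
          -z⁻¹ * ∫ y : ℝ in Set.Ioi A, f (j + 1) y * Complex.exp (-(z * y)) := by
        rw [← integral_const_mul]; congr 1; ext y; ring
      rw [e1]
      have hzA : ‖z⁻¹‖ = A := by rw [norm_inv]
      have hApow : ∀ q : ℝ, A * A ^ q = A ^ (q + 1) := fun q => by
        rw [Real.rpow_add_one hA.ne', mul_comm]
      calc _ = ‖z⁻¹ * (f j A * Complex.exp (-(z * A))) +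
              z⁻¹ * ∫ y : ℝ in Set.Ioi A, f (j + 1) y * Complex.exp (-(z * y))‖ := by
            congr 1; ring
        _ ≤ A * (B * A ^ (ρ - j)) + A * (B * (i + 1) * A ^ (ρ + 1 - (j + 1 : ℕ))) := by
            refine (norm_add_le _ _).trans ?_
            rw [norm_mul, norm_mul z⁻¹, hzA]
            gcongr
            exact hnorm' j hjK A hA
        _ = B * (A * A ^ (ρ - j)) + B * (i + 1) * (A * A ^ (ρ + 1 - (j + 1 : ℕ))) := by ring
        _ = _ := by
            rw [hApow, hApow]; push_cast
            rw [show ρ - j + 1 = ρ + 1 - j by ring, show ρ + 1 - (j + 1) + 1 = ρ + 1 - j by ring]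
            ring
  have hint0 : IntegrableOn (fun y : ℝ => f 0 y * Complex.exp (-(z * y))) (Set.Ioi 0) := by
    have h1 : IntegrableOn (fun y : ℝ => y ^ ρ * Real.exp (-z.re * y)) (Set.Ioi 0) := by
      simpa using integrableOn_rpow_mul_exp_neg_mul_rpow (show -1 < ρ by linarith) one_pos hz
        (p := 1)
    refine (h1.const_mul B).mono' (hmeas 0 0 le_rfl) ?_
    filter_upwards [ae_restrict_mem measurableSet_Ioi] with y hy
    simpa using hnorm 0 (Nat.zero_le _) y hy
  have hhead : ‖∫ y : ℝ in Set.Ioc 0 A, f 0 y * Complex.exp (-(z * y))‖ ≤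
      B * (1 / (ρ + 1)) * A ^ (ρ + 1) := by
    have hi : IntegrableOn (fun y : ℝ => y ^ ρ) (Set.Ioc 0 A) :=
      (intervalIntegrable_iff_integrableOn_Ioc_of_le hA.le).1
        (intervalIntegral.intervalIntegrable_rpow' (by linarith))
    calc _ ≤ ∫ y : ℝ in Set.Ioc 0 A, B * y ^ ρ := by
          refine norm_integral_le_of_norm_le (hi.const_mul B) ?_
          filter_upwards [ae_restrict_mem measurableSet_Ioc] with y hy
          simpa using hnorm' 0 (Nat.zero_le _) y hy.1
      _ = _ := by
          rw [integral_const_mul, ← intervalIntegral.integral_of_le hA.le,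
            integral_rpow (Or.inl (by linarith)), Real.zero_rpow hρ.ne']
          ring
  have hsplit : Set.Ioi (0 : ℝ) = Set.Ioc 0 A ∪ Set.Ioi A :=
    (Set.Ioc_union_Ioi_eq_Ioi hA.le).symm
  have htail0 := htail K le_rfl
  simp only [Nat.sub_self, CharP.cast_eq_zero, sub_zero] at htail0
  have hAz : ‖z‖ ^ (-(ρ + 1)) = A ^ (ρ + 1) := by
    rw [hAdef, Real.inv_rpow (norm_nonneg _), Real.rpow_neg (norm_nonneg _)]
  rw [hAz, hsplit, setIntegral_union (Set.Ioc_disjoint_Ioi le_rfl) measurableSet_Ioi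
    (hint0.mono_set Set.Ioc_subset_Ioi_self) (hint0.mono_set (Set.Ioi_subset_Ioi hA.le))]
  calc _ ≤ B * (1 / (ρ + 1)) * A ^ (ρ + 1) + B * (K + 1) * A ^ (ρ + 1) :=
        (norm_add_le _ _).trans (add_le_add hhead htail0)
    _ = _ := by ring

/-! ### Jets: sequences of successive derivatives -/

/-- `G 0, G 1, G 2, …` are successive derivatives of each other on `S`. Carrying the whole sequence
makes one-sided derivatives at a boundary point and Leibniz' rule equally easy to handle. -/
def IsJetOn (S : Set ℝ) (G : ℕ → ℝ → ℂ) : Prop :=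
  ∀ j, ∀ y ∈ S, HasDerivWithinAt (G j) (G (j + 1) y) S y

/-- The jet of a product, by Leibniz' rule. -/
def jetMul (F H : ℕ → ℝ → ℂ) (n : ℕ) (y : ℝ) : ℂ :=
  ∑ p ∈ Finset.HasAntidiagonal.antidiagonal n, (n.choose p.1 : ℂ) * (F p.1 y * H p.2 y)

/-- The jet of `y ↦ (κ + y)^β`. -/
def cpowJet (κ : ℝ) (β : ℂ) (j : ℕ) (y : ℝ) : ℂ :=
  (∏ i ∈ Finset.range j, (β - i)) * ((κ + y : ℝ) : ℂ) ^ (β - j)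

/-- The jet of the remainder of the Taylor polynomial of degree `< n` at `0`. -/
def taylorRem (G : ℕ → ℝ → ℂ) (n j : ℕ) (y : ℝ) : ℂ :=
  G j y - ∑ i ∈ Finset.range (n - j), G (j + i) 0 / i.factorial * (y : ℂ) ^ i

lemma IsJetOn.mono {S T : Set ℝ} {G : ℕ → ℝ → ℂ} (h : IsJetOn S G) (hT : T ⊆ S) : IsJetOn T G :=
  fun j y hy => (h j y (hT hy)).mono hT

lemma IsJetOn.hasDerivAt {G : ℕ → ℝ → ℂ} (h : IsJetOn (Set.Ioi 0) G) (j : ℕ) {y : ℝ} (hy : 0 < y) :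
    HasDerivAt (G j) (G (j + 1) y) y :=
  (h j y hy).hasDerivAt (Ioi_mem_nhds hy)

lemma isJetOn_iteratedDerivWithin {S : Set ℝ} {g : ℝ → ℂ} (hS : UniqueDiffOn ℝ S)
    (hg : ContDiffOn ℝ ∞ g S) : IsJetOn S (fun j => iteratedDerivWithin j g S) := by
  intro j y hy
  have := (hg.differentiableOn_iteratedDerivWithin (m := j) (by exact_mod_cast WithTop.coe_lt_top _)
    hS y hy).hasDerivWithinAt
  rwa [← iteratedDerivWithin_succ] at this

@[simp] lemma jetMul_zero (F H : ℕ → ℝ → ℂ) (y : ℝ) : jetMul F H 0 y = F 0 y * H 0 y := by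
  simp [jetMul]

lemma IsJetOn.mul {S : Set ℝ} {F H : ℕ → ℝ → ℂ} (hF : IsJetOn S F) (hH : IsJetOn S H) :
    IsJetOn S (jetMul F H) := by
  intro n y hy
  have key : HasDerivWithinAt (jetMul F H n)
      (∑ p ∈ Finset.HasAntidiagonal.antidiagonal n,
        (n.choose p.1 : ℂ) * (F (p.1 + 1) y * H p.2 y + F p.1 y * H (p.2 + 1) y)) S y :=
    HasDerivWithinAt.fun_sum fun p _ => ((hF p.1 y hy).mul (hH p.2 y hy)).const_mul _
  convert key using 1
  rw [jetMul, Finset.sum_antidiagonal_choose_succ_mul (fun i j => F i y * H j y) n]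
  simp only [mul_add, Finset.sum_add_distrib]
  rw [add_comm]
  congr 1
  refine Finset.sum_congr rfl fun p hp => ?_
  rw [Finset.HasAntidiagonal.mem_antidiagonal] at hp
  rw [← hp, Nat.choose_symm_add]

lemma norm_jetMul_le {F H : ℕ → ℝ → ℂ} {n : ℕ} {y W : ℝ}
    (h : ∀ i j, i + j = n → ‖F i y‖ * ‖H j y‖ ≤ W) : ‖jetMul F H n y‖ ≤ 2 ^ n * W := by
  refine (norm_sum_le _ _).trans ?_
  calc _ ≤ ∑ p ∈ Finset.HasAntidiagonal.antidiagonal n, (n.choose p.1 : ℝ) * W := by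
        refine Finset.sum_le_sum fun p hp => ?_
        rw [norm_mul, norm_mul, Complex.norm_natCast]
        exact mul_le_mul_of_nonneg_left (h _ _ (Finset.HasAntidiagonal.mem_antidiagonal.1 hp)) (Nat.cast_nonneg _)
    _ = _ := by
        rw [← Finset.sum_mul, Finset.Nat.sum_antidiagonal_eq_sum_range_succ_mk, ← Nat.cast_sum,
          Nat.sum_range_choose]
        push_cast; rfl

lemma isJetOn_cpowJet {S : Set ℝ} {κ : ℝ} (hS : ∀ y ∈ S, 0 < κ + y) (β : ℂ) :
    IsJetOn S (cpowJet κ β) := by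
  intro j y hy
  have h1 : HasDerivAt (fun z : ℂ => (κ : ℂ) + z) 1 (y : ℂ) := (hasDerivAt_id _).const_add _
  have h2 := ((h1.cpow_const (c := β - j)
    (Or.inl (by simpa using hS y hy))).const_mul (∏ i ∈ Finset.range j, (β - i))).comp_ofReal
  have h3 : cpowJet κ β j = fun y : ℝ =>
      (∏ i ∈ Finset.range j, (β - i)) * ((κ : ℂ) + y) ^ (β - j) := by
    ext y; simp [cpowJet]
  rw [h3]
  refine h2.hasDerivWithinAt.congr_deriv ?_
  rw [cpowJet, Finset.prod_range_succ]
  push_cast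
  rw [show β - (j + 1) = β - j - 1 by ring]
  ring

lemma norm_prod_sub_natCast_le (β : ℂ) (j : ℕ) :
    ‖∏ i ∈ Finset.range j, (β - i)‖ ≤ (‖β‖ + j) ^ j := by
  rw [norm_prod]
  refine (Finset.prod_le_prod (g := fun _ => ‖β‖ + j) (fun _ _ => norm_nonneg _)
    fun i hi => ?_).trans (by simp)
  refine (norm_sub_le _ _).trans ?_
  rw [Complex.norm_natCast]
  have : (i : ℝ) ≤ j := by exact_mod_cast (Finset.mem_range.1 hi).le
  gcongr

lemma norm_cpowJet_le {κ y : ℝ} (h : 0 < κ + y) (β : ℂ) (j : ℕ) :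
    ‖cpowJet κ β j y‖ ≤ (‖β‖ + j) ^ j * (κ + y) ^ (β.re - j) := by
  rw [cpowJet, norm_mul, Complex.norm_cpow_eq_rpow_re_of_pos h]
  simp only [Complex.sub_re, Complex.natCast_re]
  exact mul_le_mul_of_nonneg_right (norm_prod_sub_natCast_le β j) (by positivity)

lemma isJetOn_taylorRem {G : ℕ → ℝ → ℂ} (hG : IsJetOn (Set.Ici 0) G) (n : ℕ) :
    IsJetOn (Set.Ici 0) (taylorRem G n) := by
  intro j y hy
  have hp : ∀ (c : ℕ → ℂ) (k : ℕ), HasDerivAt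
      (fun y : ℝ => ∑ i ∈ Finset.range k, c i / i.factorial * (y : ℂ) ^ i)
      (∑ i ∈ Finset.range (k - 1), c (i + 1) / i.factorial * (y : ℂ) ^ i) y := by
    intro c k
    have h1 : HasDerivAt (fun y : ℝ => ∑ i ∈ Finset.range k, c i / i.factorial * (y : ℂ) ^ i)
        (∑ i ∈ Finset.range k, c i / i.factorial * (i * (y : ℂ) ^ (i - 1) * 1)) y :=
      HasDerivAt.fun_sum fun i _ =>
        (((Complex.ofRealCLM.hasDerivAt (x := y)).pow i).const_mul (c i / i.factorial) :)
    convert h1 using 1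
    cases k with
    | zero => simp
    | succ k =>
      rw [Finset.sum_range_succ']
      simp only [Nat.add_sub_cancel, CharP.cast_eq_zero, zero_mul, mul_zero, add_zero, mul_one]
      refine Finset.sum_congr rfl fun i _ => ?_
      rw [Nat.factorial_succ]
      have h1 : (i.factorial : ℂ) ≠ 0 := by exact_mod_cast i.factorial_ne_zero
      have h2 : ((i : ℂ) + 1) ≠ 0 := by exact_mod_cast i.succ_ne_zero
      push_cast
      field_simp
  refine ((hG j y hy).fun_sub
    (hp (fun i => G (j + i) 0) (n - j)).hasDerivWithinAt).congr_deriv ?_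
  rw [taylorRem, show n - (j + 1) = n - j - 1 by omega]
  congr 1
  refine Finset.sum_congr rfl fun i _ => ?_
  rw [show j + 1 + i = j + (i + 1) by ring]

/-- The Taylor remainder of order `n` of a compactly supported jet is a symbol of order `n` on the
whole half-line: the factor `R^K` pays for the derivatives of order at least `n`, which do not see
the Taylor polynomial, and the others follow by integration from `0`. -/
lemma norm_taylorRem_le {G : ℕ → ℝ → ℂ} (hG : IsJetOn (Set.Ici 0) G) {R B : ℝ} (hR : 1 ≤ R)
    (hsupp : ∀ j, ∀ y, R < y → G j y = 0) {K n : ℕ} (hn : n ≤ K)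
    (hB : ∀ j ≤ K, ∀ y, 0 ≤ y → ‖G j y‖ ≤ B) {j : ℕ} (hj : j ≤ K) {y : ℝ} (hy : 0 < y) :
    ‖taylorRem G n j y‖ ≤ B * R ^ K * y ^ ((n : ℝ) - j) := by
  have hB0 : 0 ≤ B := (norm_nonneg _).trans (hB 0 (Nat.zero_le _) 0 le_rfl)
  have hlow : ∀ i ≤ n, ∀ y : ℝ, 0 < y →
      ‖taylorRem G n (n - i) y‖ ≤ B * R ^ K * y ^ i := by
    intro i
    induction i with
    | zero =>
      intro _ y hy
      simp only [taylorRem, Nat.sub_zero, Nat.sub_self, Finset.range_zero, Finset.sum_empty,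
        sub_zero, pow_zero, mul_one]
      exact (hB n hn y hy.le).trans (le_mul_of_one_le_right hB0 (one_le_pow₀ hR))
    | succ i ih =>
      intro hi y hy
      have ih := ih (by omega)
      obtain ⟨j, hj⟩ : ∃ j, j = n - (i + 1) := ⟨_, rfl⟩
      rw [show n - i = j + 1 by omega] at ih
      rw [← hj]
      have h0 : taylorRem G n j 0 = 0 := by
        rw [taylorRem, show n - j = i + 1 by omega, Finset.sum_range_succ']
        simp
      have hjet := isJetOn_taylorRem hG n
      have hcont : ContinuousOn (taylorRem G n (j + 1)) (Set.Ici 0) := fun x hx =>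
        (hjet (j + 1) x hx).continuousWithinAt
      -- the bound for the next derivative extends to the endpoint by continuity
      have hbd : ∀ x ∈ Set.Ico 0 y, ‖taylorRem G n (j + 1) x‖ ≤ B * R ^ K * y ^ i := by
        have hpos : ∀ x ∈ Set.Ioo 0 y, ‖taylorRem G n (j + 1) x‖ ≤ B * R ^ K * y ^ i :=
          fun x hx => (ih x hx.1).trans (by
            have := hx.1.le
            have := hx.2.le
            gcongr)
        intro x hx
        rcases hx.1.eq_or_lt with rfl | hx0
        · have hc : Tendsto (fun x => ‖taylorRem G n (j + 1) x‖) (𝓝[>] 0)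
              (𝓝 ‖taylorRem G n (j + 1) 0‖) :=
            ((hcont 0 Set.self_mem_Ici).mono Set.Ioi_subset_Ici_self).norm
          refine le_of_tendsto hc ?_
          filter_upwards [Ioo_mem_nhdsGT hy] with x hx using hpos x hx
        · exact hpos x ⟨hx0, hx.2⟩
      have := norm_image_sub_le_of_norm_deriv_right_le_segment
        (f := taylorRem G n j) (a := 0) (b := y)
        (fun x hx => ((hjet j x hx.1).mono Set.Icc_subset_Ici_self).continuousWithinAt)
        (fun x hx => (hjet j x hx.1).mono (Set.Ici_subset_Ici.2 hx.1)) hbd y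
        (Set.right_mem_Icc.2 hy.le)
      rw [h0, sub_zero, sub_zero] at this
      refine this.trans_eq ?_
      ring
  rcases le_or_gt j n with hjn | hjn
  · have := hlow (n - j) (Nat.sub_le _ _) y hy
    rw [show n - (n - j) = j by omega] at this
    rwa [← Nat.cast_sub hjn, Real.rpow_natCast]
  · have hG' : taylorRem G n j y = G j y := by simp [taylorRem, show n - j = 0 by omega]
    rw [hG']
    rcases le_or_gt y R with hyR | hyR
    · refine (hB j hj y hy.le).trans ?_
      rw [mul_assoc]
      refine le_mul_of_one_le_right hB0 ?_
      have h1 : R ^ (-((j - n : ℕ) : ℝ)) ≤ y ^ ((n : ℝ) - j) := by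
        rw [Nat.cast_sub hjn.le, neg_sub]
        exact Real.rpow_le_rpow_of_nonpos hy hyR (by
          have : (n : ℝ) ≤ j := by exact_mod_cast hjn.le
          linarith)
      calc (1 : ℝ) = R ^ (j - n) * R ^ (-((j - n : ℕ) : ℝ)) := by
            rw [Real.rpow_neg (by positivity), Real.rpow_natCast, mul_inv_cancel₀ (by positivity)]
        _ ≤ R ^ K * y ^ ((n : ℝ) - j) := by
            gcongr
            omega
    · rw [hsupp j y hyR, norm_zero]; positivity

section

/-! ### Watson's lemma on the closed right half-plane -/

/-- The difference between the Laplace transform of `y^β G(y)` and the first `n` terms of its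
asymptotic expansion; `G` is given by its jet. On the imaginary axis the terms are the Abel-summed
Fourier integrals of `y^{β+m}`. -/
def laplaceRem (G : ℕ → ℝ → ℂ) (β : ℂ) (n : ℕ) (z : ℂ) : ℂ :=
  (∫ y : ℝ in Set.Ioi 0, (y : ℂ) ^ β * G 0 y * Complex.exp (-(z * y))) -
    ∑ m ∈ Finset.range n,
      G m 0 / m.factorial * (Complex.Gamma (β + m + 1) * z ^ (-(β + m + 1)))

lemma continuousOn_ofReal_cpow (β : ℂ) : ContinuousOn (fun y : ℝ => (y : ℂ) ^ β) (Set.Ioi 0) :=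
  fun _ hy => (Complex.continuousAt_ofReal_cpow_const _ _
    (Or.inr (ne_of_gt hy))).continuousWithinAt

lemma integrableOn_rpow_Ioc {p R : ℝ} (hp : -1 < p) (hR : 0 ≤ R) :
    IntegrableOn (fun y : ℝ => y ^ p) (Set.Ioc 0 R) :=
  (intervalIntegrable_iff_integrableOn_Ioc_of_le hR).1
    (intervalIntegral.intervalIntegrable_rpow' hp)

lemma integrableOn_cpow_mul_exp {β z : ℂ} (hβ : -1 < β.re) (hz : 0 < z.re) :
    IntegrableOn (fun y : ℝ => (y : ℂ) ^ β * Complex.exp (-(z * y))) (Set.Ioi 0) := by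
  have h1 : IntegrableOn (fun y : ℝ => y ^ β.re * Real.exp (-z.re * y)) (Set.Ioi 0) := by
    simpa using integrableOn_rpow_mul_exp_neg_mul_rpow hβ one_pos hz (p := 1)
  refine h1.mono' (((continuousOn_ofReal_cpow β).mul (by fun_prop)).aestronglyMeasurable
    measurableSet_Ioi) ?_
  filter_upwards [ae_restrict_mem measurableSet_Ioi] with y hy
  rw [norm_mul, norm_exp_neg_mul, Complex.norm_cpow_eq_rpow_re_of_pos hy]

/-- A dominating function for `y^β g(y)` when `g` is bounded and vanishes beyond `R`. -/
lemma norm_cpow_mul_le_indicator {g : ℝ → ℂ} {R B : ℝ} (hsupp : ∀ y, R < y → g y = 0)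
    (hB : ∀ y, 0 ≤ y → ‖g y‖ ≤ B) (β : ℂ) {y : ℝ} (hy : 0 < y) :
    ‖(y : ℂ) ^ β * g y‖ ≤ (Set.Ioc 0 R).indicator (fun y => y ^ β.re * B) y := by
  rcases le_or_gt y R with hyR | hyR
  · rw [Set.indicator_of_mem (Set.mem_Ioc.2 ⟨hy, hyR⟩), norm_mul,
      Complex.norm_cpow_eq_rpow_re_of_pos hy]
    have := hB y hy.le
    gcongr
  · rw [Set.indicator_of_notMem (fun h => hyR.not_ge h.2), hsupp y hyR, mul_zero, norm_zero]

lemma integrable_indicator_rpow {p R : ℝ} (hp : -1 < p) (hR : 0 ≤ R) (B : ℝ) :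
    Integrable ((Set.Ioc 0 R).indicator (fun y : ℝ => y ^ p * B)) :=
  (integrable_indicator_iff measurableSet_Ioc).2 ((integrableOn_rpow_Ioc hp hR).mul_const B)

lemma norm_exp_neg_mul_le_one {z : ℂ} (hz : 0 ≤ z.re) {y : ℝ} (hy : 0 ≤ y) :
    ‖Complex.exp (-(z * y))‖ ≤ 1 := by
  rw [norm_exp_neg_mul, Real.exp_le_one_iff]
  nlinarith

variable {G : ℕ → ℝ → ℂ} {R B : ℝ} {K n : ℕ} {β : ℂ}

lemma aestronglyMeasurable_cpow_mul (hG : IsJetOn (Set.Ici 0) G) (β z : ℂ) :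
    AEStronglyMeasurable (fun y : ℝ => (y : ℂ) ^ β * G 0 y * Complex.exp (-(z * y)))
      (volume.restrict (Set.Ioi 0)) := by
  refine ContinuousOn.aestronglyMeasurable ?_ measurableSet_Ioi
  refine ((continuousOn_ofReal_cpow β).mul fun y hy => ?_).mul (by fun_prop)
  exact ((hG.mono Set.Ioi_subset_Ici_self).hasDerivAt 0 hy).continuousAt.continuousWithinAt

lemma integrableOn_cpow_mul_jet (hG : IsJetOn (Set.Ici 0) G) (hR : 0 ≤ R)
    (hsupp : ∀ y, R < y → G 0 y = 0) (hB : ∀ y, 0 ≤ y → ‖G 0 y‖ ≤ B) (hβ : -1 < β.re)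
    {z : ℂ} (hz : 0 ≤ z.re) :
    IntegrableOn (fun y : ℝ => (y : ℂ) ^ β * G 0 y * Complex.exp (-(z * y))) (Set.Ioi 0) := by
  refine (integrable_indicator_rpow hβ hR B).integrableOn.mono'
    (aestronglyMeasurable_cpow_mul hG β z) ?_
  filter_upwards [ae_restrict_mem measurableSet_Ioi] with y hy
  rw [norm_mul]
  exact (mul_le_of_le_one_right (norm_nonneg _) (norm_exp_neg_mul_le_one hz (le_of_lt hy))).trans
    (norm_cpow_mul_le_indicator hsupp hB β hy)

lemma laplaceRem_eq_integral (hG : IsJetOn (Set.Ici 0) G) (hR : 0 ≤ R)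
    (hsupp : ∀ y, R < y → G 0 y = 0) (hB : ∀ y, 0 ≤ y → ‖G 0 y‖ ≤ B) (hβ : -1 < β.re)
    {z : ℂ} (hz : 0 < z.re) :
    laplaceRem G β n z =
      ∫ y : ℝ in Set.Ioi 0, (y : ℂ) ^ β * taylorRem G n 0 y * Complex.exp (-(z * y)) := by
  have hβm : ∀ m : ℕ, -1 < (β + m).re := fun m => by
    have : (0 : ℝ) ≤ m := m.cast_nonneg
    simp only [Complex.add_re, Complex.natCast_re]; linarith
  have hterm : ∀ m : ℕ, G m 0 / m.factorial * (Complex.Gamma (β + m + 1) * z ^ (-(β + m + 1))) =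
      ∫ y : ℝ in Set.Ioi 0, G m 0 / m.factorial *
        ((y : ℂ) ^ (β + m) * Complex.exp (-(z * y))) := fun m => by
    rw [integral_const_mul, integral_cpow_mul_exp_neg_mul (hβm m) hz]
  simp only [laplaceRem, hterm]
  rw [← integral_finsetSum _ fun m _ => (integrableOn_cpow_mul_exp (hβm m) hz).const_mul _,
    ← integral_sub (integrableOn_cpow_mul_jet hG hR hsupp hB hβ hz.le)
      (integrable_finsetSum _ fun m _ => (integrableOn_cpow_mul_exp (hβm m) hz).const_mul _)]
  refine setIntegral_congr_fun measurableSet_Ioi fun y hy => ?_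
  have hy0 : (y : ℂ) ≠ 0 := by exact_mod_cast (ne_of_gt hy)
  simp only [taylorRem, mul_sub, sub_mul, Nat.sub_zero, zero_add, Finset.mul_sum, Finset.sum_mul]
  congr 1
  refine Finset.sum_congr rfl fun m _ => ?_
  rw [Complex.cpow_add _ _ hy0, Complex.cpow_natCast]
  ring

/-- **Watson's lemma** with uniform constants, in the open half-plane. -/
lemma norm_laplaceRem_le_of_re_pos (hG : IsJetOn (Set.Ici 0) G) (hR : 1 ≤ R)
    (hsupp : ∀ j, ∀ y, R < y → G j y = 0) (hB : ∀ j ≤ K, ∀ y, 0 ≤ y → ‖G j y‖ ≤ B)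
    (hβ : -1 < β.re) (hK : β.re + n + 2 ≤ K) {z : ℂ} (hz : 0 < z.re) :
    ‖laplaceRem G β n z‖ ≤
      2 ^ K * ((‖β‖ + K + 1) ^ K * (B * R ^ K)) * (1 / (β.re + n + 1) + K + 1) *
        ‖z‖ ^ (-(β.re + n + 1)) := by
  have hnK : n ≤ K := by
    have : (n : ℝ) ≤ K := by linarith
    exact_mod_cast this
  have hB0 : 0 ≤ B := (norm_nonneg _).trans (hB 0 (Nat.zero_le _) 0 le_rfl)
  have hn0 : (0 : ℝ) ≤ n := n.cast_nonneg
  rw [laplaceRem_eq_integral hG (by linarith) (hsupp 0) (hB 0 (Nat.zero_le _)) hβ hz]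
  have hjet : IsJetOn (Set.Ioi 0) (jetMul (cpowJet 0 β) (taylorRem G n)) :=
    (isJetOn_cpowJet (fun y hy => by simpa using hy) β).mul
      ((isJetOn_taylorRem hG n).mono Set.Ioi_subset_Ici_self)
  have hmain := norm_integral_symbol_mul_exp_le (K := K) (ρ := β.re + n)
    (B := 2 ^ K * ((‖β‖ + K + 1) ^ K * (B * R ^ K)))
    (fun j y hy => hjet.hasDerivAt j hy) (fun j hj y hy => ?_) (by linarith) (by linarith) hz
  · simpa [cpowJet] using hmain
  · refine (norm_jetMul_le
      (W := (‖β‖ + K + 1) ^ K * (B * R ^ K) * y ^ (β.re + n - j)) fun i k hik => ?_).trans ?_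
    · have h1 := norm_cpowJet_le (κ := 0) (by simpa using hy) β i
      rw [zero_add] at h1
      have h2 := norm_taylorRem_le hG hR hsupp hnK hB (j := k) (by omega) hy
      have h3 : (‖β‖ + i) ^ i ≤ (‖β‖ + K + 1) ^ K := by
        have hi : (i : ℝ) ≤ K := by exact_mod_cast (by omega : i ≤ K)
        calc (‖β‖ + i) ^ i ≤ (‖β‖ + K + 1) ^ i :=
            pow_le_pow_left₀ (by positivity) (by linarith) _
          _ ≤ _ := pow_le_pow_right₀ (by have := norm_nonneg β; linarith [K.cast_nonneg (α := ℝ)])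
            (by omega)
      calc _ ≤ ((‖β‖ + K + 1) ^ K * y ^ (β.re - i)) * (B * R ^ K * y ^ ((n : ℝ) - k)) := by
            gcongr
            exact h1.trans (by gcongr)
        _ = (‖β‖ + K + 1) ^ K * (B * R ^ K) * (y ^ (β.re - i) * y ^ ((n : ℝ) - k)) := by ring
        _ = _ := by
            rw [← Real.rpow_add hy]
            congr 2
            rw [← hik]; push_cast; ring
    · rw [← mul_assoc]
      gcongr
      exact one_le_two

/-- **Watson's lemma** with uniform constants, up to the boundary of the half-plane. On the
imaginary axis it is obtained as a limit. -/
lemma norm_laplaceRem_le (hG : IsJetOn (Set.Ici 0) G) (hR : 1 ≤ R)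
    (hsupp : ∀ j, ∀ y, R < y → G j y = 0) (hB : ∀ j ≤ K, ∀ y, 0 ≤ y → ‖G j y‖ ≤ B)
    (hβ : -1 < β.re) (hK : β.re + n + 2 ≤ K) {z : ℂ} (hz : 0 ≤ z.re) (hz0 : z ≠ 0) :
    ‖laplaceRem G β n z‖ ≤
      2 ^ K * ((‖β‖ + K + 1) ^ K * (B * R ^ K)) * (1 / (β.re + n + 1) + K + 1) *
        ‖z‖ ^ (-(β.re + n + 1)) := by
  have hslit : z ∈ Complex.slitPlane := by
    rcases hz.eq_or_lt with h | h
    · exact Or.inr fun h' => hz0 (Complex.ext h.symm h')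
    · exact Or.inl h
  have hw : Tendsto (fun ε : ℝ => z + (ε : ℂ)) (𝓝[>] 0) (𝓝 z) := by
    have : Continuous fun ε : ℝ => z + (ε : ℂ) := by fun_prop
    simpa using (this.tendsto 0).mono_left nhdsWithin_le_nhds
  have hre : ∀ ε : ℝ, 0 < ε → 0 < (z + (ε : ℂ)).re := fun ε hε => by
    simp only [Complex.add_re, Complex.ofReal_re]; linarith
  have hlimL : Tendsto (fun ε : ℝ => laplaceRem G β n (z + ε)) (𝓝[>] 0)
      (𝓝 (laplaceRem G β n z)) := by
    refine Tendsto.sub ?_ ?_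
    · refine tendsto_integral_filter_of_dominated_convergence
        ((Set.Ioc 0 R).indicator (fun y : ℝ => y ^ β.re * B)) ?_ ?_
        (integrable_indicator_rpow hβ (by linarith) B).integrableOn ?_
      · exact .of_forall fun ε => aestronglyMeasurable_cpow_mul hG β _
      · filter_upwards [self_mem_nhdsWithin] with ε hε
        filter_upwards [ae_restrict_mem measurableSet_Ioi] with y hy
        rw [norm_mul]
        exact (mul_le_of_le_one_right (norm_nonneg _)
          (norm_exp_neg_mul_le_one (hre ε hε).le (le_of_lt hy))).trans
          (norm_cpow_mul_le_indicator (hsupp 0) (hB 0 (Nat.zero_le _)) β hy)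
      · refine .of_forall fun y => ?_
        have : Continuous fun w : ℂ => (y : ℂ) ^ β * G 0 y * Complex.exp (-(w * y)) := by
          fun_prop
        exact (this.tendsto z).comp hw
    · refine tendsto_finsetSum _ fun m _ => ((Tendsto.const_mul _ ?_).const_mul _)
      exact (continuousAt_cpow_const hslit).tendsto.comp hw
  have hlimR : Tendsto (fun ε : ℝ => 2 ^ K * ((‖β‖ + K + 1) ^ K * (B * R ^ K)) *
      (1 / (β.re + n + 1) + K + 1) * ‖z + (ε : ℂ)‖ ^ (-(β.re + n + 1))) (𝓝[>] 0)
      (𝓝 (2 ^ K * ((‖β‖ + K + 1) ^ K * (B * R ^ K)) * (1 / (β.re + n + 1) + K + 1) *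
        ‖z‖ ^ (-(β.re + n + 1)))) :=
    (hw.norm.rpow_const (Or.inl (norm_ne_zero_iff.2 hz0))).const_mul _
  refine le_of_tendsto_of_tendsto hlimL.norm hlimR ?_
  filter_upwards [self_mem_nhdsWithin] with ε hε
  exact norm_laplaceRem_le_of_re_pos hG hR hsupp hB hβ hK (hre ε hε)

end

section

/-! ### The one-sided remainder and its dependence on the Mellin variable -/

/-- The jet of `y ↦ g(y) (2 + y)^{u/2}`, where `γ` is the jet of `g`. -/
def edgeJet (γ : ℕ → ℝ → ℂ) (u : ℂ) : ℕ → ℝ → ℂ := jetMul γ (cpowJet 2 (u / 2))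

/-- The remainder after `n` terms in the expansion in `d` of
`∫₀^∞ y^{(a+u)/2} g(y) (2+y)^{u/2} e(dy) dy`. -/
def edgeRem (γ : ℕ → ℝ → ℂ) (a : ℂ) (n : ℕ) (d : ℝ) (u : ℂ) : ℂ :=
  laplaceRem (edgeJet γ u) ((a + u) / 2) n (-(2 * Real.pi * Complex.I * d))

variable {γ : ℕ → ℝ → ℂ} {R : ℝ}

lemma isJetOn_edgeJet (hγ : IsJetOn (Set.Ici 0) γ) (u : ℂ) : IsJetOn (Set.Ici 0) (edgeJet γ u) :=
  hγ.mul (isJetOn_cpowJet (fun y hy => by have : 0 ≤ y := hy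
                                          linarith) _)

lemma edgeJet_eq_zero (hsupp : ∀ j, ∀ y, R < y → γ j y = 0) (u : ℂ) (j : ℕ) {y : ℝ} (hy : R < y) :
    edgeJet γ u j y = 0 := by
  simp [edgeJet, jetMul, hsupp _ _ hy]

lemma exists_bound_jet (hγ : IsJetOn (Set.Ici 0) γ) (hsupp : ∀ j, ∀ y, R < y → γ j y = 0) (K : ℕ) :
    ∃ B : ℝ, 0 ≤ B ∧ ∀ j ≤ K, ∀ y, 0 ≤ y → ‖γ j y‖ ≤ B := by
  have h1 : ∀ j, ∃ B : ℝ, 0 ≤ B ∧ ∀ y, 0 ≤ y → ‖γ j y‖ ≤ B := fun j => by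
    have hc : ContinuousOn (γ j) (Set.Icc 0 R) := fun y hy =>
      (hγ j y hy.1).continuousWithinAt.mono Set.Icc_subset_Ici_self
    obtain ⟨B, hB⟩ := isCompact_Icc.exists_bound_of_continuousOn hc
    refine ⟨max B 0, le_max_right _ _, fun y hy => ?_⟩
    rcases le_or_gt y R with hyR | hyR
    · exact (hB y ⟨hy, hyR⟩).trans (le_max_left _ _)
    · rw [hsupp j y hyR, norm_zero]; exact le_max_right _ _
  choose B hB0 hB using h1
  refine ⟨∑ j ∈ Finset.range (K + 1), B j, Finset.sum_nonneg fun j _ => hB0 j,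
    fun j hj y hy => (hB j y hy).trans ?_⟩
  exact Finset.single_le_sum (fun j _ => hB0 j) (Finset.mem_range.2 (by omega))

lemma norm_edgeJet_le (hR : 1 ≤ R) (hsupp : ∀ j, ∀ y, R < y → γ j y = 0) {K : ℕ} {B : ℝ}
    (hB0 : 0 ≤ B) (hB : ∀ j ≤ K, ∀ y, 0 ≤ y → ‖γ j y‖ ≤ B) {σ : ℝ} {u : ℂ} (hu : u.re ≤ σ)
    {j : ℕ} (hj : j ≤ K) {y : ℝ} (hy : 0 ≤ y) :
    ‖edgeJet γ u j y‖ ≤ 2 ^ K * (B * ((‖u‖ + K + 1) ^ K * (2 + R) ^ |σ|)) := by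
  rcases le_or_gt y R with hyR | hyR
  · refine (norm_jetMul_le (W := B * ((‖u‖ + K + 1) ^ K * (2 + R) ^ |σ|))
      fun i k hik => ?_).trans ?_
    · have hk : (k : ℝ) ≤ K := by exact_mod_cast (by omega : k ≤ K)
      have hu2 : ‖u / 2‖ ≤ ‖u‖ := by
        rw [norm_div, Complex.norm_ofNat]; linarith [norm_nonneg u]
      have hb := norm_cpowJet_le (κ := 2) (y := y) (by linarith) (u / 2) k
      have hb1 : (‖u / 2‖ + k) ^ k ≤ (‖u‖ + K + 1) ^ K :=
        calc _ ≤ (‖u‖ + K + 1) ^ k := pow_le_pow_left₀ (by positivity) (by linarith) _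
          _ ≤ _ := pow_le_pow_right₀ (by have := norm_nonneg u; linarith [K.cast_nonneg (α := ℝ)])
            (by omega)
      have hb2 : (2 + y) ^ ((u / 2).re - k) ≤ (2 + R) ^ |σ| := by
        have h2 : (u / 2).re = u.re / 2 := by simp
        calc _ ≤ (2 + y) ^ |σ| := by
              refine Real.rpow_le_rpow_of_exponent_le (by linarith) ?_
              rw [h2]
              have := le_abs_self σ
              have := abs_nonneg σ
              have : (0 : ℝ) ≤ k := k.cast_nonneg
              linarith
          _ ≤ _ := by gcongr
      have := hB i (by omega) y hy
      gcongr
      exact hb.trans (by gcongr)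
    · gcongr
      exact one_le_two
  · rw [edgeJet_eq_zero hsupp u j hyR, norm_zero]
    positivity

/-- The remainder has the expected size in `d` for all `d ≠ 0`, with constants growing at most
polynomially in `u` on vertical strips. -/
lemma exists_norm_edgeRem_le (hγ : IsJetOn (Set.Ici 0) γ) (hR : 1 ≤ R)
    (hsupp : ∀ j, ∀ y, R < y → γ j y = 0) (a : ℂ) (n : ℕ) {σ₁ : ℝ} (σ₂ : ℝ)
    (hσ : -2 < a.re + σ₁) :
    ∃ (C : ℝ) (N : ℕ), 0 ≤ C ∧ ∀ u : ℂ, σ₁ ≤ u.re → u.re ≤ σ₂ → ∀ d : ℝ, d ≠ 0 →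
      ‖edgeRem γ a n d u‖ ≤ C * (1 + ‖u‖) ^ N * |d| ^ (-((a.re + u.re) / 2 + n + 1)) := by
  obtain ⟨K, hK⟩ := exists_nat_ge ((a.re + σ₂) / 2 + n + 2)
  obtain ⟨B, hB0, hB⟩ := exists_bound_jet hγ hsupp K
  have hη : 0 < (a.re + σ₁) / 2 + 1 := by linarith
  have hn0 : (0 : ℝ) ≤ n := n.cast_nonneg
  have hK0 : (0 : ℝ) ≤ K := K.cast_nonneg
  refine ⟨2 ^ K * ((‖a‖ + K + 1) ^ K * ((2 ^ K * (B * ((K + 1) ^ K * (2 + R) ^ |σ₂|))) * R ^ K)) *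
    (1 / ((a.re + σ₁) / 2 + 1) + K + 1), 2 * K, by positivity, fun u h1 h2 d hd => ?_⟩
  have hβre : ((a + u) / 2).re = (a.re + u.re) / 2 := by simp
  have hz0 : -(2 * Real.pi * Complex.I * d) ≠ 0 := by
    simp [Real.pi_ne_zero, hd]
  have hmain := norm_laplaceRem_le (isJetOn_edgeJet hγ u) hR
    (fun j y hy => edgeJet_eq_zero hsupp u j hy)
    (fun j hj y hy => norm_edgeJet_le hR hsupp hB0 hB h2 hj hy) (n := n) (β := (a + u) / 2)
    (by rw [hβre]; linarith) (by rw [hβre]; linarith) (z := -(2 * Real.pi * Complex.I * d))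
    (by simp) hz0
  refine hmain.trans ?_
  rw [hβre]
  have hnz : ‖-(2 * Real.pi * Complex.I * d)‖ = 2 * Real.pi * |d| := by
    simp [abs_of_pos Real.pi_pos]
  rw [hnz]
  have hd0 : 0 < |d| := abs_pos.2 hd
  have e1 : (2 * Real.pi * |d|) ^ (-((a.re + u.re) / 2 + n + 1)) ≤
      |d| ^ (-((a.re + u.re) / 2 + n + 1)) := by
    refine Real.rpow_le_rpow_of_nonpos hd0 ?_ (by linarith)
    have := Real.pi_gt_three
    nlinarith
  have e2 : (‖(a + u) / 2‖ + K + 1) ^ K ≤ (‖a‖ + K + 1) ^ K * (1 + ‖u‖) ^ K := by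
    rw [← mul_pow]
    refine pow_le_pow_left₀ (by positivity) ?_ _
    have h3 : ‖(a + u) / 2‖ ≤ ‖a‖ + ‖u‖ := by
      rw [norm_div, Complex.norm_ofNat]
      have := norm_add_le a u
      have := norm_nonneg (a + u)
      linarith
    have := norm_nonneg a
    have := norm_nonneg u
    nlinarith
  have e3 : (‖u‖ + K + 1) ^ K ≤ (K + 1) ^ K * (1 + ‖u‖) ^ K := by
    rw [← mul_pow]
    refine pow_le_pow_left₀ (by positivity) ?_ _
    have := norm_nonneg u
    nlinarith
  have e4 : 1 / ((a.re + u.re) / 2 + n + 1) ≤ 1 / ((a.re + σ₁) / 2 + 1) :=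
    one_div_le_one_div_of_le hη (by linarith)
  have e5 : 0 ≤ 1 / ((a.re + u.re) / 2 + n + 1) :=
    one_div_nonneg.2 (by linarith)
  calc _ ≤ 2 ^ K * ((‖a‖ + K + 1) ^ K * (1 + ‖u‖) ^ K *
        ((2 ^ K * (B * ((K + 1) ^ K * (1 + ‖u‖) ^ K * (2 + R) ^ |σ₂|))) * R ^ K)) *
        (1 / ((a.re + σ₁) / 2 + 1) + K + 1) * |d| ^ (-((a.re + u.re) / 2 + n + 1)) := by
        gcongr
    _ = _ := by ring

lemma differentiableAt_cpowJet_exponent {κ y : ℝ} (h : 0 < κ + y) (j : ℕ) (u : ℂ) :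
    DifferentiableAt ℂ (fun u : ℂ => cpowJet κ (u / 2) j y) u := by
  unfold cpowJet
  refine DifferentiableAt.mul ?_ ?_
  · exact DifferentiableAt.fun_finsetProd fun i _ => by fun_prop
  · exact DifferentiableAt.const_cpow (by fun_prop)
      (Or.inl (by exact_mod_cast h.ne'))

lemma rpow_le_rpow_add_rpow {y p p₁ p₂ : ℝ} (hy : 0 < y) (h1 : p₁ ≤ p) (h2 : p ≤ p₂) :
    y ^ p ≤ y ^ p₁ + y ^ p₂ := by
  rcases le_or_gt y 1 with h | h
  · exact (Real.rpow_le_rpow_of_exponent_ge hy h h1).trans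
      (le_add_of_nonneg_right (by positivity))
  · exact (Real.rpow_le_rpow_of_exponent_le h.le h2).trans
      (le_add_of_nonneg_left (by positivity))

lemma differentiableAt_edgeRem (hγ : IsJetOn (Set.Ici 0) γ) (hR : 1 ≤ R)
    (hsupp : ∀ j, ∀ y, R < y → γ j y = 0) (a : ℂ) (n : ℕ) {d : ℝ} (hd : d ≠ 0) {u₀ : ℂ}
    (hu₀ : -2 < a.re + u₀.re) : DifferentiableAt ℂ (edgeRem γ a n d) u₀ := by
  have hz0 : -(2 * Real.pi * Complex.I * d) ≠ 0 := by
    simp [Real.pi_ne_zero, hd]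
  unfold edgeRem laplaceRem
  refine DifferentiableAt.fun_sub ?_ (DifferentiableAt.fun_sum fun m _ => ?_)
  · obtain ⟨B, hB0, hB⟩ := exists_bound_jet hγ hsupp 0
    obtain ⟨r, hr⟩ : ∃ r, r = (a.re + u₀.re + 2) / 2 := ⟨_, rfl⟩
    have hr0 : 0 < r := by rw [hr]; linarith
    obtain ⟨B', hB'⟩ : ∃ B', B' = B * (2 + R) ^ |u₀.re + r| := ⟨_, rfl⟩
    refine differentiableAt_integral_of_dominated hr0
      (bound := fun y => (Set.Ioc 0 R).indicator (fun y => y ^ ((a.re + u₀.re - r) / 2) * B') y +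
        (Set.Ioc 0 R).indicator (fun y => y ^ ((a.re + u₀.re + r) / 2) * B') y) ?_
      (fun u _ => aestronglyMeasurable_cpow_mul (isJetOn_edgeJet hγ u) _ _) ?_ ?_
    · exact ((integrable_indicator_rpow (by linarith) (by linarith) B').add
        (integrable_indicator_rpow (by linarith) (by linarith) B')).integrableOn
    · filter_upwards [ae_restrict_mem measurableSet_Ioi] with y hy u _
      have hy' : 0 < y := hy
      refine DifferentiableAt.differentiableWithinAt ?_
      refine ((DifferentiableAt.const_cpow (by fun_prop)
        (Or.inl (by exact_mod_cast hy'.ne'))).fun_mul ?_).mul_const _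
      simp only [edgeJet, jetMul_zero]
      exact (differentiableAt_cpowJet_exponent (by linarith) _ _).const_mul _
    · filter_upwards [ae_restrict_mem measurableSet_Ioi] with y hy u hu
      have hy' : 0 < y := hy
      have h1 : |(u - u₀).re| < r :=
        (Complex.abs_re_le_norm _).trans_lt (by rwa [Metric.mem_ball, dist_eq_norm] at hu)
      rw [Complex.sub_re, abs_lt] at h1
      have hjet : ∀ y, 0 ≤ y → ‖edgeJet γ u 0 y‖ ≤ B' := fun y hy => by
        have := norm_edgeJet_le hR hsupp hB0 hB (σ := u₀.re + r) (u := u) (by linarith) le_rfl hy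
        simpa [hB'] using this
      rw [norm_mul]
      refine (mul_le_of_le_one_right (norm_nonneg _)
        (norm_exp_neg_mul_le_one (by simp) (le_of_lt hy))).trans
        ((norm_cpow_mul_le_indicator (R := R) (fun y hy => edgeJet_eq_zero hsupp u 0 hy)
          hjet _ hy).trans ?_)
      by_cases hyR : y ∈ Set.Ioc 0 R
      · simp only [Set.indicator_of_mem hyR]
        rw [← add_mul]
        have hB'0 : 0 ≤ B' := by rw [hB']; positivity
        refine mul_le_mul_of_nonneg_right (rpow_le_rpow_add_rpow hy' ?_ ?_) hB'0 <;>
        · simp only [Complex.div_ofNat_re, Complex.add_re]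
          linarith
      · simp [Set.indicator_of_notMem hyR]
  · have hre : ∀ k : ℕ, ((a + u₀) / 2 + m + 1) ≠ -(k : ℂ) := fun k h => by
      have := congrArg Complex.re h
      simp at this
      have h1 : (0 : ℝ) ≤ m := m.cast_nonneg
      have h2 : (0 : ℝ) ≤ k := k.cast_nonneg
      linarith
    refine DifferentiableAt.fun_mul ?_ (DifferentiableAt.fun_mul ?_ ?_)
    · simp only [edgeJet, jetMul]
      refine DifferentiableAt.div_const (DifferentiableAt.fun_sum fun p _ => ?_) _
      exact ((differentiableAt_cpowJet_exponent (by norm_num) _ _).const_mul _).const_mul _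
    · exact (Complex.differentiableAt_Gamma _ hre).comp
        (f := fun u : ℂ => (a + u) / 2 + m + 1) u₀ (by fun_prop)
    · exact DifferentiableAt.const_cpow (by fun_prop) (Or.inl hz0)

end

/-! ### The expansion at the edges `±1` -/

/-- The jet on `y ≥ 0` of `g_s(y) = (2 + y)^{a/2} h₁(s(1 + y))`, the smooth factor in
`h(s(1 + y)) = y^{a/2} g_s(y)`. -/
def sideJet (a : ℂ) (h₁ : ℝ → ℂ) (s : ℤˣ) : ℕ → ℝ → ℂ :=
  jetMul (cpowJet 2 (a / 2))
    (fun j => iteratedDerivWithin j (fun y : ℝ => h₁ (((s : ℤ) : ℝ) * (1 + y))) (Set.Ici 0))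

lemma abs_units_cast (s : ℤˣ) : |((s : ℤ) : ℝ)| = 1 := by
  rcases Int.units_eq_one_or s with rfl | rfl <;> simp

lemma units_cast_ne_zero (s : ℤˣ) : ((s : ℤ) : ℝ) ≠ 0 := by
  rcases Int.units_eq_one_or s with rfl | rfl <;> simp

lemma isJetOn_sideJet (a : ℂ) {h₁ : ℝ → ℂ} (hsmooth : ContDiffOn ℝ ∞ h₁ {x : ℝ | 1 ≤ |x|})
    (s : ℤˣ) : IsJetOn (Set.Ici 0) (sideJet a h₁ s) := by
  refine (isJetOn_cpowJet (fun y hy => ?_) _).mul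
    (isJetOn_iteratedDerivWithin (uniqueDiffOn_Ici 0) ?_)
  · have : 0 ≤ y := hy
    linarith
  · refine hsmooth.comp (ContDiff.contDiffOn (by fun_prop)) fun y hy => ?_
    have hy' : 0 ≤ y := hy
    rw [Set.mem_ofPred_eq, abs_mul, abs_units_cast, one_mul, abs_of_nonneg (by linarith)]
    linarith

lemma IsJetOn.eq_zero_of_lt {G : ℕ → ℝ → ℂ} (hG : IsJetOn (Set.Ici 0) G) {R : ℝ} (hR : 0 ≤ R)
    (h0 : ∀ y, R < y → G 0 y = 0) (j : ℕ) : ∀ y, R < y → G j y = 0 := by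
  induction j with
  | zero => exact h0
  | succ j ih =>
    intro y hy
    have h1 := (hG.mono Set.Ioi_subset_Ici_self).hasDerivAt j (hR.trans_lt hy)
    have h2 : G j =ᶠ[𝓝 y] fun _ => 0 := by
      filter_upwards [Ioi_mem_nhds hy] with x hx using ih x hx
    exact (h1.congr_of_eventuallyEq h2.symm).unique (hasDerivAt_const y 0)

lemma exists_sideJet_eq_zero (a : ℂ) {h₁ : ℝ → ℂ} (hsupp : HasCompactSupport h₁)
    (hsmooth : ContDiffOn ℝ ∞ h₁ {x : ℝ | 1 ≤ |x|}) :
    ∃ R : ℝ, 1 ≤ R ∧ ∀ (s : ℤˣ) (j : ℕ) (y : ℝ), R < y → sideJet a h₁ s j y = 0 := by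
  obtain ⟨R, hR⟩ := hsupp.isCompact.isBounded.exists_norm_le
  refine ⟨max R 1, le_max_right _ _, fun s j => ?_⟩
  refine (isJetOn_sideJet a hsmooth s).eq_zero_of_lt (zero_le_one.trans (le_max_right _ _))
    (fun y hy => ?_) j
  have hy1 : 1 < y := (le_max_right _ _).trans_lt hy
  have : h₁ (((s : ℤ) : ℝ) * (1 + y)) = 0 := by
    refine image_eq_zero_of_notMem_tsupport fun hmem => ?_
    have := hR _ hmem
    rw [Real.norm_eq_abs, abs_mul, abs_units_cast, one_mul, abs_of_pos (by linarith)] at this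
    linarith [(le_max_left R 1).trans_lt hy]
  simp [sideJet, this]

lemma apply_edge_eq {a : ℂ} {h₁ h : ℝ → ℂ}
    (hh : ∀ x : ℝ, h x = ((|1 - x ^ 2| : ℝ) : ℂ) ^ (a / 2) * h₁ x) (s : ℤˣ) {y : ℝ} (hy : 0 < y) :
    h (((s : ℤ) : ℝ) * (1 + y)) = (y : ℂ) ^ (a / 2) * sideJet a h₁ s 0 y := by
  have h1 : |1 - (((s : ℤ) : ℝ) * (1 + y)) ^ 2| = y * (2 + y) := by
    rw [mul_pow, ← sq_abs ((s : ℤ) : ℝ), abs_units_cast,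
      show (1 : ℝ) - 1 ^ 2 * (1 + y) ^ 2 = -(y * (2 + y)) by ring, abs_neg,
      abs_of_pos (by positivity)]
  rw [hh, h1, Complex.ofReal_mul, Complex.mul_cpow_ofReal_nonneg hy.le (by linarith)]
  simp [sideJet, cpowJet, mul_assoc]

/-- A power series which vanishes to all orders in the sense of asymptotic expansions is zero. -/
lemma eq_zero_of_forall_isBigO {b : ℕ → ℂ}
    (h : ∀ M : ℕ, (fun y : ℝ => ∑ i ∈ Finset.range (M + 1), b i * (y : ℂ) ^ i)
      =O[𝓝[>] 0] fun y : ℝ => y ^ (M + 1)) (M : ℕ) : b M = 0 := by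
  induction M using Nat.strong_induction_on with
  | _ M ih =>
    have h1 : (fun y : ℝ => b M * (y : ℂ) ^ M) =O[𝓝[>] 0] fun y : ℝ => y ^ (M + 1) := by
      refine (h M).congr_left fun y => ?_
      rw [Finset.sum_range_succ, Finset.sum_eq_zero, zero_add]
      intro i hi
      rw [ih i (Finset.mem_range.1 hi), zero_mul]
    have h2 : (fun _ : ℝ => b M) =O[𝓝[>] 0] fun y : ℝ => y := by
      obtain ⟨A, hA⟩ := h1.bound
      refine IsBigO.of_bound A ?_
      filter_upwards [hA, self_mem_nhdsWithin] with y hy hy0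
      have hy' : 0 < y := hy0
      rw [norm_mul, norm_pow, Complex.norm_real, Real.norm_of_nonneg hy'.le,
        Real.norm_of_nonneg (by positivity), pow_succ', ← mul_assoc,
        mul_le_mul_iff_left₀ (by positivity)] at hy
      rwa [Real.norm_of_nonneg hy'.le]
    have h3 : Tendsto (fun _ : ℝ => b M) (𝓝[>] (0 : ℝ)) (𝓝 0) :=
      h2.trans_tendsto (tendsto_id.mono_left nhdsWithin_le_nhds)
    exact tendsto_nhds_unique tendsto_const_nhds h3

lemma sideJet_zero_eq {a : ℂ} {h₁ h : ℝ → ℂ} (hsupp : HasCompactSupport h₁)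
    (hsmooth : ContDiffOn ℝ ∞ h₁ {x : ℝ | 1 ≤ |x|})
    (hh : ∀ x : ℝ, h x = ((|1 - x ^ 2| : ℝ) : ℂ) ^ (a / 2) * h₁ x) {s : ℤˣ} {c : ℕ → ℂ}
    (hc : HasAsympExpansion (𝓝[<] 0) (fun x : ℝ => h (((s : ℤ) : ℝ) * (1 - x))) (a / 2) c)
    (m : ℕ) : sideJet a h₁ s m 0 / m.factorial = c m * (-1) ^ m := by
  rw [← sub_eq_zero]
  refine eq_zero_of_forall_isBigO
    (b := fun m => sideJet a h₁ s m 0 / m.factorial - c m * (-1) ^ m) (fun M => ?_) m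
  obtain ⟨R, hR, hR0⟩ := exists_sideJet_eq_zero a hsupp hsmooth
  have hjet := isJetOn_sideJet a hsmooth s
  obtain ⟨B, hB0, hB⟩ := exists_bound_jet hjet (hR0 s) (M + 1)
  have h1 : (fun y : ℝ => taylorRem (sideJet a h₁ s) (M + 1) 0 y)
      =O[𝓝[>] 0] fun y : ℝ => y ^ (M + 1) := by
    refine IsBigO.of_bound (B * R ^ (M + 1)) ?_
    filter_upwards [self_mem_nhdsWithin] with y hy
    have hy' : 0 < y := hy
    have := norm_taylorRem_le hjet hR (hR0 s) le_rfl hB (Nat.zero_le _) hy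
    rw [Nat.cast_zero, sub_zero, Real.rpow_natCast] at this
    rwa [Real.norm_of_nonneg (by positivity)]
  have h2 : (fun y : ℝ => sideJet a h₁ s 0 y -
      ∑ m ∈ Finset.range (M + 1), c m * (-1) ^ m * (y : ℂ) ^ m)
      =O[𝓝[>] 0] fun y : ℝ => y ^ (M + 1) := by
    have hneg : Tendsto (fun y : ℝ => -y) (𝓝[>] 0) (𝓝[<] 0) := by
      simpa using tendsto_neg_nhdsGT (a := (0 : ℝ))
    obtain ⟨A, hA⟩ := ((hc M).comp_tendsto hneg).bound
    refine IsBigO.of_bound A ?_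
    filter_upwards [hA, self_mem_nhdsWithin] with y hy hy0
    have hy' : 0 < y := hy0
    simp only [Function.comp_apply, sub_neg_eq_add, abs_neg, abs_of_pos hy'] at hy
    rw [apply_edge_eq hh s hy', ← mul_sub, norm_mul, Complex.norm_cpow_eq_rpow_re_of_pos hy',
      Real.norm_of_nonneg (by positivity), add_assoc, Real.rpow_add hy'] at hy
    have h3 : (a / 2).re = a.re / 2 := by simp
    have hpos : 0 < y ^ (a / 2).re := by positivity
    have h4 : y ^ ((M : ℝ) + 1) = y ^ (M + 1) := by exact_mod_cast Real.rpow_natCast y (M + 1)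
    rw [mul_left_comm, mul_le_mul_iff_right₀ hpos, h4] at hy
    rw [Real.norm_of_nonneg (by positivity)]
    refine le_trans (le_of_eq ?_) hy
    congr 2
    refine Finset.sum_congr rfl fun m _ => ?_
    push_cast
    rw [neg_pow]; ring
  refine (h2.sub h1).congr_left fun y => ?_
  simp only [taylorRem, Nat.sub_zero, zero_add, sub_mul, Finset.sum_sub_distrib]
  ring

lemma cpowJet_zero_div_factorial {κ : ℝ} (hκ : 0 < κ) (v : ℂ) (j : ℕ) :
    cpowJet κ v j 0 / j.factorial = (κ : ℂ) ^ v / (κ : ℂ) ^ j * Ring.choose v j := by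
  have hdp : (descPochhammer ℤ j).smeval v = ∏ i ∈ Finset.range j, (v - i) := by
    rw [← Polynomial.aeval_eq_smeval, Polynomial.aeval_def, ← Polynomial.eval_map,
      algebraMap_int_eq, descPochhammer_map, descPochhammer_eval_eq_prod_range]
  rw [cpowJet, Ring.choose_eq_smul, hdp, add_zero,
    Complex.cpow_sub _ _ (by exact_mod_cast hκ.ne'), Complex.cpow_natCast, smul_eq_mul]
  ring

/-- The Taylor coefficients of `g(y) (2 + y)^v` by the binomial series. -/
lemma edgeJet_zero_div_factorial {γ : ℕ → ℝ → ℂ} {c : ℕ → ℂ}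
    (hγ : ∀ m, γ m 0 / m.factorial = c m * (-1) ^ m) (u : ℂ) (m : ℕ) :
    edgeJet γ u m 0 / m.factorial = (-1) ^ m * (2 : ℂ) ^ (u / 2) *
      ∑ p ∈ Finset.HasAntidiagonal.antidiagonal m,
        c p.2 / (-2) ^ p.1 * Ring.choose (u / 2) p.1 := by
  rw [edgeJet, jetMul, Finset.sum_div, ← Finset.Nat.sum_antidiagonal_swap, Finset.mul_sum]
  refine Finset.sum_congr rfl fun p hp => ?_
  rw [Finset.HasAntidiagonal.mem_antidiagonal] at hp
  have h1 : ((m.choose p.2 : ℕ) : ℂ) = m.factorial / (p.2.factorial * p.1.factorial) := by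
    rw [← hp, add_comm, Nat.cast_add_choose]
  have hm : (m.factorial : ℂ) ≠ 0 := by exact_mod_cast m.factorial_ne_zero
  have h2 := hγ p.2
  have h3 := cpowJet_zero_div_factorial (κ := 2) two_pos (u / 2) p.1
  simp only [Prod.fst_swap, Prod.snd_swap]
  calc _ = (γ p.2 0 / p.2.factorial) * (cpowJet 2 (u / 2) p.1 0 / p.1.factorial) := by
        rw [h1]; field_simp
    _ = _ := by
        rw [h2, h3, ← hp, neg_pow 2 p.1, pow_add]
        push_cast
        field_simp

/-- Branches: `(-2πid)^{-w} = (i/2π)^w d^{-w}` with principal values, for both signs of `d`. -/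
lemma neg_two_pi_I_mul_cpow {d : ℝ} (hd : d ≠ 0) (w : ℂ) :
    (-(2 * Real.pi * Complex.I * d)) ^ (-w) =
      (Complex.I / (2 * Real.pi)) ^ w * (d : ℂ) ^ (-w) := by
  have hπ : (Real.pi : ℂ) ≠ 0 := by exact_mod_cast Real.pi_ne_zero
  have hdC : (d : ℂ) ≠ 0 := by exact_mod_cast hd
  have h1 : -(2 * Real.pi * Complex.I * d) ≠ 0 := by simp [Real.pi_ne_zero, hd]
  have h2 : Complex.I / (2 * Real.pi) ≠ 0 := by simp [Real.pi_ne_zero]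
  rw [Complex.cpow_def_of_ne_zero h1, Complex.cpow_def_of_ne_zero h2,
    Complex.cpow_def_of_ne_zero hdC, ← Complex.exp_add]
  congr 1
  have hI : Complex.log (Complex.I / (2 * Real.pi)) =
      -(Real.log (2 * Real.pi) : ℂ) + Real.pi / 2 * Complex.I := by
    rw [show Complex.I / (2 * Real.pi) = (((2 * Real.pi)⁻¹ : ℝ) : ℂ) * Complex.I by
      push_cast; field_simp, Complex.log_ofReal_mul (by positivity) Complex.I_ne_zero,
      Complex.log_I, Real.log_inv]
    push_cast; rfl
  rw [hI]
  rcases lt_or_gt_of_ne hd with h | h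
  · have e1 : Complex.log (-(2 * Real.pi * Complex.I * d)) =
        Real.log (2 * Real.pi) + Real.log (-d) + Real.pi / 2 * Complex.I := by
      rw [show -(2 * Real.pi * Complex.I * d) = ((2 * Real.pi * (-d) : ℝ) : ℂ) * Complex.I by
        push_cast; ring, Complex.log_ofReal_mul
        (mul_pos (by positivity) (neg_pos.2 h)) Complex.I_ne_zero, Complex.log_I,
        Real.log_mul (by positivity) (neg_ne_zero.2 hd)]
      push_cast; rfl
    have e2 : Complex.log d = Real.log (-d) + Real.pi * Complex.I := by
      rw [show (d : ℂ) = ((-d : ℝ) : ℂ) * (-1) by push_cast; ring,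
        Complex.log_ofReal_mul (neg_pos.2 h) (by simp), Complex.log_neg_one]
    rw [e1, e2]; ring
  · have e1 : Complex.log (-(2 * Real.pi * Complex.I * d)) =
        Real.log (2 * Real.pi) + Real.log d - Real.pi / 2 * Complex.I := by
      rw [show -(2 * Real.pi * Complex.I * d) = ((2 * Real.pi * d : ℝ) : ℂ) * (-Complex.I) by
        push_cast; ring, Complex.log_ofReal_mul
        (by positivity) (by simp), Complex.log_neg_I,
        Real.log_mul (by positivity) hd]
      push_cast; ring
    rw [e1, ← Complex.ofReal_log h.le]; ring

lemma mul_sq_cpow_neg_half {C d : ℝ} (hC : 0 < C) (hd : d ≠ 0) (u : ℂ) :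
    ((C ^ 2 * d : ℝ) : ℂ) ^ (-(u / 2)) = (C : ℂ) ^ (-u) * (d : ℂ) ^ (-(u / 2)) := by
  have hdC : (d : ℂ) ≠ 0 := by exact_mod_cast hd
  have hCC : (C : ℂ) ≠ 0 := by exact_mod_cast hC.ne'
  rw [Complex.ofReal_mul, Complex.cpow_def_of_ne_zero
    (mul_ne_zero (by exact_mod_cast (pow_pos hC 2).ne') hdC),
    Complex.cpow_def_of_ne_zero hCC, Complex.cpow_def_of_ne_zero hdC, ← Complex.exp_add,
    Complex.log_ofReal_mul (by positivity) hdC, Real.log_pow, ← Complex.ofReal_log hC.le]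
  congr 1
  push_cast; ring

/-- The terms subtracted in `edgeRem` are the integrands of the transforms. -/
lemma transformIntegrand_eq {a : ℂ} {γ : ℕ → ℝ → ℂ} {c : ℕ → ℂ}
    (hγ : ∀ m, γ m 0 / m.factorial = c m * (-1) ^ m) (Φ : ℝ → ℂ) (m : ℕ) {C d : ℝ} (hC : 0 < C)
    (hd : d ≠ 0) (u : ℂ) :
    (-1) ^ m * transformIntegrand a c m Φ (C ^ 2 * d) u / (d : ℂ) ^ ((m : ℂ) + 1 + a / 2) =
      mellin Φ u * (C : ℂ) ^ (-u) * (edgeJet γ u m 0 / m.factorial *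
        (Complex.Gamma ((a + u) / 2 + m + 1) *
          (-(2 * Real.pi * Complex.I * d)) ^ (-((a + u) / 2 + m + 1)))) := by
  have hdC : (d : ℂ) ≠ 0 := by exact_mod_cast hd
  rw [edgeJet_zero_div_factorial hγ, neg_two_pi_I_mul_cpow hd, transformIntegrand, coeff,
    mul_sq_cpow_neg_half hC hd,
    show -((a + u) / 2 + m + 1) = -(u / 2) + -((m : ℂ) + 1 + a / 2) by ring,
    Complex.cpow_add (-(u / 2)) (-((m : ℂ) + 1 + a / 2)) hdC, Complex.cpow_neg _ ((m : ℂ) + 1 + a / 2),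
    show (m : ℂ) + 1 + (a + u) / 2 = (a + u) / 2 + m + 1 by ring,
    show 1 + (m : ℂ) + u / 2 + a / 2 = (a + u) / 2 + m + 1 by ring]
  ring

section

/-! ### The Mellin transform of a Schwartz-type function on the half-line -/

variable {Φ : ℝ → ℂ}

lemma IsHalfLineSchwartz.isJetOn (hΦ : IsHalfLineSchwartz Φ) :
    IsJetOn (Set.Ioi 0) (fun k => iteratedDeriv k Φ) := by
  intro k y hy
  refine (isJetOn_iteratedDerivWithin (uniqueDiffOn_Ioi 0) hΦ.1 k y hy).congr_deriv ?_ |>.congr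
    (fun x hx => ?_) ?_
  · exact iteratedDerivWithin_of_isOpen isOpen_Ioi hy
  · exact (iteratedDerivWithin_of_isOpen isOpen_Ioi hx).symm
  · exact (iteratedDerivWithin_of_isOpen isOpen_Ioi hy).symm

lemma IsHalfLineSchwartz.continuousOn (hΦ : IsHalfLineSchwartz Φ) (k : ℕ) :
    ContinuousOn (iteratedDeriv k Φ) (Set.Ioi 0) :=
  fun y hy => (hΦ.isJetOn k y hy).continuousWithinAt

lemma IsHalfLineSchwartz.exists_bound (hΦ : IsHalfLineSchwartz Φ) (k : ℕ) {σ : ℝ} (hσ : 0 < σ) :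
    ∃ A : ℝ, 0 ≤ A ∧ ∀ x : ℝ, 0 < x → ‖iteratedDeriv k Φ x‖ ≤ A * x ^ (-(k + σ)) := by
  obtain ⟨A, hA⟩ := hΦ.2 k σ hσ
  refine ⟨A, ?_, fun x hx => ?_⟩
  · exact (mul_nonneg (by positivity) (norm_nonneg _)).trans (hA 1 one_pos)
  · have := hA x hx
    rw [Real.rpow_neg hx.le, ← div_eq_mul_inv, le_div_iff₀' (by positivity)]
    exact this

lemma IsHalfLineSchwartz.isBigO (hΦ : IsHalfLineSchwartz Φ) (k : ℕ) {σ : ℝ} (hσ : 0 < σ)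
    {l : Filter ℝ} (hl : ∀ᶠ x in l, 0 < x) :
    iteratedDeriv k Φ =O[l] fun x => x ^ (-(k + σ)) := by
  obtain ⟨A, -, hA⟩ := hΦ.exists_bound k hσ
  refine IsBigO.of_bound A ?_
  filter_upwards [hl] with x hx
  rw [Real.norm_of_nonneg (by positivity)]
  exact hA x hx

lemma IsHalfLineSchwartz.mellinConvergent_iteratedDeriv (hΦ : IsHalfLineSchwartz Φ) (k : ℕ)
    {s : ℂ} (hs : k < s.re) : MellinConvergent (iteratedDeriv k Φ) s :=
  mellinConvergent_of_isBigO_rpow (a := k + (s.re - k + 1)) (b := k + (s.re - k) / 2)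
    ((hΦ.continuousOn k).locallyIntegrableOn measurableSet_Ioi)
    (hΦ.isBigO k (by linarith) (eventually_gt_atTop 0)) (by linarith)
    (hΦ.isBigO k (by linarith) self_mem_nhdsWithin) (by linarith)

lemma IsHalfLineSchwartz.mellinConvergent (hΦ : IsHalfLineSchwartz Φ) {u : ℂ} (hu : 0 < u.re) :
    MellinConvergent Φ u := by
  simpa using hΦ.mellinConvergent_iteratedDeriv 0 (s := u) (by simpa using hu)

lemma IsHalfLineSchwartz.differentiableAt_mellin (hΦ : IsHalfLineSchwartz Φ) {u : ℂ}
    (hu : 0 < u.re) : DifferentiableAt ℂ (mellin Φ) u := by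
  have h1 := (hΦ.continuousOn 0).locallyIntegrableOn (μ := volume) measurableSet_Ioi
  have h2 := hΦ.isBigO 0 (σ := u.re + 1) (by linarith) (eventually_gt_atTop 0)
  have h3 := hΦ.isBigO 0 (σ := u.re / 2) (by linarith) (l := 𝓝[>] 0) self_mem_nhdsWithin
  rw [iteratedDeriv_zero] at h1 h2 h3
  exact mellin_differentiableAt_of_isBigO_rpow h1 h2 (by simp) h3 (by simp; linarith)

/-- Integration by parts. -/
lemma IsHalfLineSchwartz.mellin_iteratedDeriv_succ (hΦ : IsHalfLineSchwartz Φ) (k : ℕ) {u : ℂ}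
    (hu : 0 < u.re) :
    mellin (iteratedDeriv (k + 1) Φ) (u + (k + 1 : ℕ)) =
      -((u + k) * mellin (iteratedDeriv k Φ) (u + k)) := by
  have hk : (0 : ℝ) ≤ k := k.cast_nonneg
  have hne : u + k ≠ 0 := fun h => by
    have := congrArg Complex.re h
    simp at this; linarith
  have hnorm : ∀ σ : ℝ, ∀ A x : ℝ, 0 < x → ‖iteratedDeriv k Φ x‖ ≤ A * x ^ (-(k + σ)) →
      ‖((fun x : ℝ => (x : ℂ) ^ (u + k)) * iteratedDeriv k Φ) x‖ ≤ A * x ^ (u.re - σ) := by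
    intro σ A x hx h
    rw [Pi.mul_apply, norm_mul, Complex.norm_cpow_eq_rpow_re_of_pos hx]
    calc _ ≤ x ^ (u + k).re * (A * x ^ (-(k + σ))) := by gcongr
      _ = A * (x ^ (u + k).re * x ^ (-(k + σ))) := by ring
      _ = _ := by
        rw [← Real.rpow_add hx]; congr 2; simp only [Complex.add_re, Complex.natCast_re]; ring
  have hconv0 := hΦ.mellinConvergent_iteratedDeriv k (s := u + k) (by simpa using hu)
  have hconv1 := hΦ.mellinConvergent_iteratedDeriv (k + 1) (s := u + (k + 1 : ℕ))
    (by simpa using hu)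
  have hexp : u + ((k + 1 : ℕ) : ℂ) - 1 = u + k := by push_cast; ring
  rw [MellinConvergent, hexp] at hconv1
  have hibp := integral_Ioi_mul_deriv_eq_deriv_mul (a := (0 : ℝ))
    (u := fun x : ℝ => (x : ℂ) ^ (u + k)) (u' := fun x : ℝ => (u + k) * (x : ℂ) ^ (u + k - 1))
    (v := iteratedDeriv k Φ) (v' := iteratedDeriv (k + 1) Φ) (a' := 0) (b' := 0)
    (fun x hx => by
      have hx' : 0 < x := hx
      simpa using ((hasDerivAt_id (x : ℂ)).cpow_const (c := u + k)
        (Or.inl (by simpa using hx'))).comp_ofReal)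
    (fun x hx => hΦ.isJetOn.hasDerivAt k hx)
    (hconv1.congr (.of_forall fun x => by simp))
    (by
      refine (hconv0.const_mul (u + k)).congr (.of_forall fun x => ?_)
      simp only [Pi.mul_apply, smul_eq_mul]; ring)
    (by
      obtain ⟨A, -, hA⟩ := hΦ.exists_bound k (half_pos hu)
      refine squeeze_zero_norm' (a := fun x => A * x ^ (u.re - u.re / 2)) ?_ ?_
      · filter_upwards [self_mem_nhdsWithin] with x hx using hnorm _ A x hx (hA x hx)
      · have := ((Real.continuousAt_rpow_const 0 (u.re - u.re / 2)
          (Or.inr (by linarith))).tendsto.mono_left (nhdsWithin_le_nhds (s := Set.Ioi 0))).const_mul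
            A
        rwa [Real.zero_rpow (by linarith), mul_zero] at this)
    (by
      obtain ⟨A, -, hA⟩ := hΦ.exists_bound k (show 0 < 2 * u.re by linarith)
      refine squeeze_zero_norm' (a := fun x => A * x ^ (u.re - 2 * u.re)) ?_ ?_
      · filter_upwards [eventually_gt_atTop 0] with x hx using hnorm _ A x hx (hA x hx)
      · have := (tendsto_rpow_neg_atTop hu).const_mul A
        rw [mul_zero] at this
        rwa [show u.re - 2 * u.re = -u.re by ring])
  simp only [mellin, hexp, smul_eq_mul]
  rw [hibp, ← integral_const_mul]
  simp only [sub_zero, zero_sub, mul_assoc]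

/-- The Mellin transform decreases faster than any power of `u` in closed vertical strips inside
`Re u > 0`. -/
lemma IsHalfLineSchwartz.exists_norm_mellin_le (hΦ : IsHalfLineSchwartz Φ) (N : ℕ) {σ₁ σ₂ : ℝ}
    (hσ : 0 < σ₁) :
    ∃ A : ℝ, ∀ u : ℂ, σ₁ ≤ u.re → u.re ≤ σ₂ → ‖u‖ ^ N * ‖mellin Φ u‖ ≤ A := by
  have hpow : ∀ u : ℂ, 0 < u.re → ‖u‖ ^ N * ‖mellin Φ u‖ ≤
      ‖mellin (iteratedDeriv N Φ) (u + N)‖ := by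
    intro u hu
    induction N with
    | zero => simp
    | succ k ih =>
      rw [hΦ.mellin_iteratedDeriv_succ k hu, norm_neg, norm_mul, pow_succ', mul_assoc]
      have h1 : ‖u‖ ≤ ‖u + k‖ := by
        rw [Complex.norm_eq_sqrt_sq_add_sq, Complex.norm_eq_sqrt_sq_add_sq]
        refine Real.sqrt_le_sqrt ?_
        simp only [Complex.add_re, Complex.natCast_re, Complex.add_im, Complex.natCast_im, add_zero]
        have : (0 : ℝ) ≤ k := k.cast_nonneg
        gcongr
        linarith
      gcongr
  have hi : ∀ σ : ℝ, 0 < σ → IntegrableOn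
      (fun x : ℝ => x ^ (σ + N - 1) * ‖iteratedDeriv N Φ x‖) (Set.Ioi 0) := by
    intro σ hσ
    have h1 := hΦ.mellinConvergent_iteratedDeriv N (s := ((σ + N : ℝ) : ℂ)) (by simpa using hσ)
    rw [MellinConvergent, mellin_convergent_iff_norm subset_rfl measurableSet_Ioi
      ((hΦ.continuousOn N).aestronglyMeasurable measurableSet_Ioi)] at h1
    simpa using h1
  refine ⟨∫ x : ℝ in Set.Ioi 0, (x ^ (σ₁ + N - 1) * ‖iteratedDeriv N Φ x‖ +
    x ^ (max σ₁ σ₂ + N - 1) * ‖iteratedDeriv N Φ x‖), fun u h1 h2 => ?_⟩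
  refine (hpow u (hσ.trans_le h1)).trans ?_
  refine norm_integral_le_of_norm_le
    ((hi σ₁ hσ).add (hi (max σ₁ σ₂) (hσ.trans_le (le_max_left _ _)))) ?_
  filter_upwards [ae_restrict_mem measurableSet_Ioi] with x hx
  have hx' : 0 < x := hx
  rw [norm_smul, Complex.norm_cpow_eq_rpow_re_of_pos hx', ← add_mul]
  refine mul_le_mul_of_nonneg_right (rpow_le_rpow_add_rpow hx' ?_ ?_) (norm_nonneg _)
  · simp only [Complex.sub_re, Complex.add_re, Complex.natCast_re, Complex.one_re]; linarith
  · simp only [Complex.sub_re, Complex.add_re, Complex.natCast_re, Complex.one_re]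
    linarith [h2.trans (le_max_right σ₁ σ₂)]

end

section

/-! ### Mellin inversion and the two sides of `|x| > 1` -/

lemma e_units_mul_add (s : ℤˣ) (y D : ℝ) :
    e (((s : ℤ) : ℝ) * (1 + y) * D) = e (((s : ℤ) : ℝ) * D) *
      Complex.exp (-(-(2 * Real.pi * Complex.I * (((s : ℤ) : ℝ) * D : ℝ)) * y)) := by
  rw [e, e, ← Complex.exp_add]
  congr 1; push_cast; ring

lemma norm_e (x : ℝ) : ‖e x‖ = 1 := by
  rw [e, Complex.norm_exp]; simp

lemma setOf_one_lt_abs : {x : ℝ | 1 < |x|} = Set.Iio (-1) ∪ Set.Ioi 1 := by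
  ext x; simp [lt_abs, or_comm, lt_neg]

lemma measurePreserving_units_mul_add (s : ℤˣ) :
    MeasurePreserving (fun y : ℝ => ((s : ℤ) : ℝ) * (1 + y)) ∧
      MeasurableEmbedding (fun y : ℝ => ((s : ℤ) : ℝ) * (1 + y)) := by
  have h1 := measurePreserving_add_left (volume : Measure ℝ) 1
  have e1 := measurableEmbedding_addLeft (1 : ℝ)
  rcases Int.units_eq_one_or s with rfl | rfl
  · simpa using And.intro h1 e1
  · have h2 := (Measure.measurePreserving_neg (volume : Measure ℝ)).comp h1
    have e2 := (MeasurableEquiv.neg ℝ).measurableEmbedding.comp e1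
    have hfun : (fun y : ℝ => (((-1 : ℤˣ) : ℤ) : ℝ) * (1 + y)) = Neg.neg ∘ fun y => 1 + y := by
      ext y; simp
    rw [hfun]
    exact ⟨h2, e2⟩

lemma preimage_units_mul_add :
    (fun y : ℝ => (((1 : ℤˣ) : ℤ) : ℝ) * (1 + y)) ⁻¹' Set.Ioi 1 = Set.Ioi 0 ∧
      (fun y : ℝ => (((-1 : ℤˣ) : ℤ) : ℝ) * (1 + y)) ⁻¹' Set.Iio (-1) = Set.Ioi 0 := by
  constructor <;> ext y <;> simp

lemma integrableOn_one_lt_abs {f : ℝ → ℂ}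
    (hf : ∀ s : ℤˣ, IntegrableOn (fun y : ℝ => f (((s : ℤ) : ℝ) * (1 + y))) (Set.Ioi 0)) :
    IntegrableOn f {x : ℝ | 1 < |x|} := by
  obtain ⟨p1, p2⟩ := preimage_units_mul_add
  rw [setOf_one_lt_abs]
  refine IntegrableOn.union ?_ ?_
  · obtain ⟨h1, h2⟩ := measurePreserving_units_mul_add (-1)
    rw [← h1.integrableOn_comp_preimage h2, p2]
    exact hf (-1)
  · obtain ⟨h1, h2⟩ := measurePreserving_units_mul_add 1
    rw [← h1.integrableOn_comp_preimage h2, p1]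
    exact hf 1

lemma setIntegral_one_lt_abs {f : ℝ → ℂ} (hf : IntegrableOn f {x : ℝ | 1 < |x|}) :
    ∫ x in {x : ℝ | 1 < |x|}, f x =
      ∑ s : ℤˣ, ∫ y : ℝ in Set.Ioi 0, f (((s : ℤ) : ℝ) * (1 + y)) := by
  obtain ⟨p1, p2⟩ := preimage_units_mul_add
  rw [setOf_one_lt_abs] at hf ⊢
  have hdisj : Disjoint (Set.Iio (-1 : ℝ)) (Set.Ioi 1) := Set.disjoint_left.2 fun x hx hx' => by
    rw [Set.mem_Iio] at hx
    rw [Set.mem_Ioi] at hx'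
    linarith
  rw [setIntegral_union hdisj measurableSet_Ioi hf.left_of_union hf.right_of_union]
  have hsum : ∀ F : ℤˣ → ℂ, ∑ s : ℤˣ, F s = F (-1) + F 1 := fun F => by
    rw [UnitsInt.univ, Finset.sum_pair (by decide), add_comm]
  rw [hsum]
  congr 1
  · obtain ⟨h1, h2⟩ := measurePreserving_units_mul_add (-1)
    rw [← h1.setIntegral_preimage_emb h2, p2]
  · obtain ⟨h1, h2⟩ := measurePreserving_units_mul_add 1
    rw [← h1.setIntegral_preimage_emb h2, p1]

/-- The integrand of the Mellin–Fourier double integral on one side: `y` is the distance to the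
edge and `u` the Mellin variable. -/
def sideIntegrand (Φ : ℝ → ℂ) (γ : ℕ → ℝ → ℂ) (a : ℂ) (C d : ℝ) (u : ℂ) (y : ℝ) : ℂ :=
  mellin Φ u * (C : ℂ) ^ (-u) * ((y : ℂ) ^ ((a + u) / 2) * edgeJet γ u 0 y *
    Complex.exp (-(-(2 * Real.pi * Complex.I * d) * y)))

variable {Φ : ℝ → ℂ} {γ : ℕ → ℝ → ℂ} {R : ℝ} {a : ℂ} {τ C : ℝ}

lemma IsHalfLineSchwartz.continuous_mellin_vertical (hΦ : IsHalfLineSchwartz Φ) (hτ : 0 < τ) :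
    Continuous fun t : ℝ => mellin Φ (τ + t * Complex.I) :=
  continuous_iff_continuousAt.2 fun t =>
    ContinuousAt.comp (f := fun t : ℝ => (τ : ℂ) + t * Complex.I)
      (hΦ.differentiableAt_mellin (by simpa using hτ)).continuousAt (by fun_prop)

lemma one_add_sq_mul_le {u : ℂ} {b A₁ A₂ : ℝ} (hb : 0 ≤ b) (h1 : b ≤ A₁)
    (h2 : ‖u‖ ^ 2 * b ≤ A₂) : (1 + u.im ^ 2) * b ≤ A₁ + A₂ := by
  have : u.im ^ 2 ≤ ‖u‖ ^ 2 := by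
    rw [← sq_abs]; exact pow_le_pow_left₀ (abs_nonneg _) (Complex.abs_im_le_norm u) 2
  nlinarith [mul_le_mul_of_nonneg_right this hb]

/-- Integrability on a vertical line from quadratic decay. -/
lemma integrable_vertical {F : ℂ → ℂ} (hF : Continuous fun t : ℝ => F (τ + t * Complex.I)) {A : ℝ}
    (hA : ∀ t : ℝ, (1 + t ^ 2) * ‖F (τ + t * Complex.I)‖ ≤ A) :
    Integrable fun t : ℝ => F (τ + t * Complex.I) := by
  refine (integrable_inv_one_add_sq.const_mul A).mono' hF.aestronglyMeasurable
    (.of_forall fun t => ?_)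
  rw [← div_eq_mul_inv, le_div_iff₀' (by positivity)]
  exact hA t

lemma IsHalfLineSchwartz.integrable_mellin_vertical (hΦ : IsHalfLineSchwartz Φ) (hτ : 0 < τ) :
    Integrable fun t : ℝ => mellin Φ (τ + t * Complex.I) := by
  obtain ⟨A₁, h1⟩ := hΦ.exists_norm_mellin_le 0 (σ₂ := τ) hτ
  obtain ⟨A₂, h2⟩ := hΦ.exists_norm_mellin_le 2 (σ₂ := τ) hτ
  refine integrable_vertical (hΦ.continuous_mellin_vertical hτ) (A := A₁ + A₂) fun t => ?_
  have := one_add_sq_mul_le (u := τ + t * Complex.I) (norm_nonneg _)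
    (by simpa using h1 (τ + t * Complex.I) (by simp) (by simp))
    (h2 (τ + t * Complex.I) (by simp) (by simp))
  simpa using this

lemma norm_sideIntegrand_le (hR : 1 ≤ R) (hsupp : ∀ j, ∀ y, R < y → γ j y = 0) {B : ℝ}
    (hB0 : 0 ≤ B) (hB : ∀ j ≤ 0, ∀ y, 0 ≤ y → ‖γ j y‖ ≤ B) (hC : 0 < C) (d : ℝ) (u : ℂ)
    {y : ℝ} (hy : 0 < y) :
    ‖sideIntegrand Φ γ a C d u y‖ ≤
      (Set.Ioc 0 R).indicator (fun y => y ^ ((a.re + u.re) / 2) * (B * (2 + R) ^ |u.re|)) y *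
        (‖mellin Φ u‖ * C ^ (-u.re)) := by
  have hjet : ∀ y, 0 ≤ y → ‖edgeJet γ u 0 y‖ ≤ B * (2 + R) ^ |u.re| := fun y hy => by
    simpa using norm_edgeJet_le hR hsupp hB0 hB (σ := u.re) (u := u) le_rfl le_rfl hy
  have hre : ((a + u) / 2).re = (a.re + u.re) / 2 := by simp
  rw [sideIntegrand, norm_mul, norm_mul (mellin Φ u), Complex.norm_cpow_eq_rpow_re_of_pos hC,
    Complex.neg_re, mul_comm, norm_mul]
  refine mul_le_mul_of_nonneg_right ?_ (by positivity)
  refine (mul_le_of_le_one_right (norm_nonneg _)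
    (norm_exp_neg_mul_le_one (by simp) hy.le)).trans ?_
  rw [← hre]
  exact norm_cpow_mul_le_indicator (fun y hy => edgeJet_eq_zero hsupp u 0 hy) hjet _ hy

lemma integrable_sideIntegrand (hΦ : IsHalfLineSchwartz Φ) (hγ : IsJetOn (Set.Ici 0) γ)
    (hR : 1 ≤ R) (hsupp : ∀ j, ∀ y, R < y → γ j y = 0) (ha : -2 < a.re) (hτ : 0 < τ) (hC : 0 < C)
    (d : ℝ) :
    Integrable (Function.uncurry fun (y t : ℝ) =>
        sideIntegrand Φ γ a C d (τ + t * Complex.I) y)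
      ((volume.restrict (Set.Ioi 0)).prod volume) := by
  obtain ⟨B, hB0, hB⟩ := exists_bound_jet hγ hsupp 0
  have hdom : Integrable (fun p : ℝ × ℝ =>
      (Set.Ioc 0 R).indicator (fun y => y ^ ((a.re + τ) / 2) * (B * (2 + R) ^ |τ|)) p.1 *
        (‖mellin Φ (τ + p.2 * Complex.I)‖ * C ^ (-τ)))
      ((volume.restrict (Set.Ioi 0)).prod volume) :=
    (integrable_indicator_rpow (by linarith) (by linarith) _).integrableOn.mul_prod
      ((hΦ.integrable_mellin_vertical hτ).norm.mul_const _)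
  have hmeasure : (volume.restrict (Set.Ioi (0 : ℝ))).prod (volume : Measure ℝ) =
      (volume.prod volume).restrict (Set.Ioi 0 ×ˢ Set.univ) := by
    rw [← Measure.prod_restrict, Measure.restrict_univ]
  refine hdom.mono' ?_ ?_
  · rw [hmeasure]
    refine ContinuousOn.aestronglyMeasurable ?_ (measurableSet_Ioi.prod MeasurableSet.univ)
    simp only [Function.uncurry_def, sideIntegrand, edgeJet, jetMul_zero, cpowJet]
    have hu : Continuous fun p : ℝ × ℝ => (τ : ℂ) + p.2 * Complex.I := by fun_prop
    have hmel : Continuous fun p : ℝ × ℝ => mellin Φ (τ + p.2 * Complex.I) :=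
      (hΦ.continuous_mellin_vertical hτ).comp continuous_snd
    have hCpow : Continuous fun p : ℝ × ℝ => (C : ℂ) ^ (-((τ : ℂ) + p.2 * Complex.I)) :=
      hu.neg.const_cpow (Or.inl (by exact_mod_cast hC.ne'))
    have hy1 : ContinuousOn (fun p : ℝ × ℝ => (p.1 : ℂ) ^ ((a + (τ + p.2 * Complex.I)) / 2))
        (Set.Ioi 0 ×ˢ Set.univ) := by
      refine ContinuousOn.cpow (by fun_prop) (by fun_prop) fun p hp => ?_
      exact Or.inl (by simpa using hp.1)
    have hy2 : ContinuousOn (fun p : ℝ × ℝ =>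
        ((2 + p.1 : ℝ) : ℂ) ^ ((τ + p.2 * Complex.I) / 2 - (0 : ℕ)))
        (Set.Ioi 0 ×ˢ Set.univ) := by
      refine ContinuousOn.cpow (by fun_prop) (by fun_prop) fun p hp => ?_
      have : 0 < p.1 := hp.1
      exact Or.inl (by rw [Complex.ofReal_re]; linarith)
    have hg : ContinuousOn (fun p : ℝ × ℝ => γ 0 p.1) (Set.Ioi 0 ×ˢ Set.univ) := by
      refine ContinuousOn.comp (g := γ 0) (t := Set.Ici 0) (fun y hy => ?_) (by fun_prop)
        fun p hp => Set.mem_Ici.2 (le_of_lt hp.1)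
      exact (hγ 0 y hy).continuousWithinAt
    refine (hmel.mul hCpow).continuousOn.mul ((hy1.mul (hg.mul ?_)).mul
      (Continuous.continuousOn (by fun_prop)))
    exact continuousOn_const.mul hy2
  · rw [hmeasure]
    filter_upwards [ae_restrict_mem (measurableSet_Ioi.prod MeasurableSet.univ)] with p hp
    have := norm_sideIntegrand_le (Φ := Φ) (a := a) hR hsupp hB0 hB hC d
      (τ + p.2 * Complex.I) hp.1
    simpa [Function.uncurry_def] using this

/-- Mellin inversion under the `y`-integral. -/
lemma integral_sideIntegrand (hΦ : IsHalfLineSchwartz Φ) (hτ : 0 < τ) (hC : 0 < C) (d : ℝ) {y : ℝ}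
    (hy : 0 < y) :
    ∫ t : ℝ, sideIntegrand Φ γ a C d (τ + t * Complex.I) y =
      2 * Real.pi * ((y : ℂ) ^ (a / 2) * γ 0 y * Φ (C / √(y * (2 + y))) *
        Complex.exp (-(-(2 * Real.pi * Complex.I * d) * y))) := by
  have hq : 0 < y * (2 + y) := by positivity
  have hw : 0 < C / √(y * (2 + y)) := by positivity
  have hcont : ContinuousAt Φ (C / √(y * (2 + y))) := by
    simpa using (hΦ.isJetOn.hasDerivAt 0 hw).continuousAt
  have hinv := mellinInv_mellin_eq τ Φ hw (hΦ.mellinConvergent (by simpa using hτ))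
    (hΦ.integrable_mellin_vertical hτ) hcont
  rw [← hinv, mellinInv]
  have hpow : ∀ u : ℂ, ((C / √(y * (2 + y)) : ℝ) : ℂ) ^ (-u) =
      (C : ℂ) ^ (-u) * ((y : ℂ) ^ (u / 2) * ((2 + y : ℝ) : ℂ) ^ (u / 2)) := by
    intro u
    have hC0 : (C : ℂ) ≠ 0 := by exact_mod_cast hC.ne'
    have hy0 : (y : ℂ) ≠ 0 := by exact_mod_cast hy.ne'
    have h20 : ((2 + y : ℝ) : ℂ) ≠ 0 := by
      exact_mod_cast (by positivity : (2 + y : ℝ) ≠ 0)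
    rw [Complex.cpow_def_of_ne_zero (by exact_mod_cast hw.ne'), Complex.cpow_def_of_ne_zero hC0,
      Complex.cpow_def_of_ne_zero hy0, Complex.cpow_def_of_ne_zero h20, ← Complex.exp_add,
      ← Complex.exp_add, ← Complex.ofReal_log hw.le, ← Complex.ofReal_log hC.le,
      ← Complex.ofReal_log hy.le, ← Complex.ofReal_log (by positivity),
      Real.log_div hC.ne' (by positivity), Real.log_sqrt hq.le,
      Real.log_mul hy.ne' (by positivity)]
    congr 1
    push_cast; ring
  have hfun : ∀ t : ℝ, sideIntegrand Φ γ a C d (τ + t * Complex.I) y =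
      ((y : ℂ) ^ (a / 2) * γ 0 y * Complex.exp (-(-(2 * Real.pi * Complex.I * d) * y))) *
        (((C / √(y * (2 + y)) : ℝ) : ℂ) ^ (-((τ : ℂ) + t * Complex.I)) •
          mellin Φ (τ + t * Complex.I)) := by
    intro t
    have hy0 : (y : ℂ) ≠ 0 := by exact_mod_cast hy.ne'
    rw [hpow, sideIntegrand, edgeJet, jetMul_zero, cpowJet, add_div, Complex.cpow_add _ _ hy0]
    simp only [Finset.range_zero, Finset.prod_empty, Nat.cast_zero, sub_zero, one_mul, smul_eq_mul]
    ring
  simp only [hfun]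
  rw [integral_const_mul, Complex.real_smul]
  have hπ : (Real.pi : ℂ) ≠ 0 := by exact_mod_cast Real.pi_ne_zero
  push_cast
  field_simp

/-- The contribution of one side as a vertical integral. -/
lemma integral_side_eq (hΦ : IsHalfLineSchwartz Φ) (hγ : IsJetOn (Set.Ici 0) γ)
    (hR : 1 ≤ R) (hsupp : ∀ j, ∀ y, R < y → γ j y = 0) (ha : -2 < a.re) (hτ : 0 < τ) (hC : 0 < C)
    (d : ℝ) :
    ∫ y : ℝ in Set.Ioi 0, (y : ℂ) ^ (a / 2) * γ 0 y * Φ (C / √(y * (2 + y))) *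
        Complex.exp (-(-(2 * Real.pi * Complex.I * d) * y)) =
      1 / (2 * Real.pi) * ∫ t : ℝ, mellin Φ (τ + t * Complex.I) *
        (C : ℂ) ^ (-((τ : ℂ) + t * Complex.I)) * edgeRem γ a 0 d (τ + t * Complex.I) := by
  have hswap := integral_integral_swap (integrable_sideIntegrand hΦ hγ hR hsupp ha hτ hC d)
  have h1 : ∫ y : ℝ in Set.Ioi 0, ∫ t : ℝ, sideIntegrand Φ γ a C d (τ + t * Complex.I) y =
      2 * Real.pi * ∫ y : ℝ in Set.Ioi 0, (y : ℂ) ^ (a / 2) * γ 0 y * Φ (C / √(y * (2 + y))) *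
        Complex.exp (-(-(2 * Real.pi * Complex.I * d) * y)) := by
    rw [← integral_const_mul]
    exact setIntegral_congr_fun measurableSet_Ioi fun y hy =>
      integral_sideIntegrand hΦ hτ hC d hy
  have h2 : ∀ t : ℝ, ∫ y : ℝ in Set.Ioi 0, sideIntegrand Φ γ a C d (τ + t * Complex.I) y =
      mellin Φ (τ + t * Complex.I) * (C : ℂ) ^ (-((τ : ℂ) + t * Complex.I)) *
        edgeRem γ a 0 d (τ + t * Complex.I) := fun t => by
    simp only [sideIntegrand, edgeRem, laplaceRem, Finset.range_zero, Finset.sum_empty, sub_zero]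
    rw [integral_const_mul]
  rw [h1] at hswap
  simp only [h2] at hswap
  rw [← hswap]
  have hπ : (Real.pi : ℂ) ≠ 0 := by exact_mod_cast Real.pi_ne_zero
  field_simp

lemma integrableOn_side (hΦ : IsHalfLineSchwartz Φ) (hγ : IsJetOn (Set.Ici 0) γ)
    (hR : 1 ≤ R) (hsupp : ∀ j, ∀ y, R < y → γ j y = 0) (ha : -2 < a.re) (hC : 0 < C) (d : ℝ) :
    IntegrableOn (fun y : ℝ => (y : ℂ) ^ (a / 2) * γ 0 y * Φ (C / √(y * (2 + y))) *
        Complex.exp (-(-(2 * Real.pi * Complex.I * d) * y))) (Set.Ioi 0) := by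
  have h1 := (integrable_sideIntegrand hΦ hγ hR hsupp ha one_pos hC d).integral_prod_left
  have hπ : (2 * Real.pi : ℂ) ≠ 0 := by simp [Real.pi_ne_zero]
  refine (h1.const_mul (2 * Real.pi : ℂ)⁻¹).congr ?_
  filter_upwards [ae_restrict_mem measurableSet_Ioi] with y hy
  simp only [Function.uncurry_apply_pair]
  rw [integral_sideIntegrand hΦ one_pos hC d hy, inv_mul_cancel_left₀ hπ]

end

/-! ### Estimates for vertical integrals -/

lemma norm_integral_vertical_le {F : ℂ → ℂ} {σ A : ℝ}
    (hA : ∀ t : ℝ, (1 + t ^ 2) * ‖F (σ + t * Complex.I)‖ ≤ A) :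
    ‖∫ t : ℝ, F (σ + t * Complex.I)‖ ≤ A * Real.pi := by
  rw [← integral_univ_inv_one_add_sq, ← integral_const_mul]
  refine norm_integral_le_of_norm_le (integrable_inv_one_add_sq.const_mul A)
    (.of_forall fun t => ?_)
  rw [← div_eq_mul_inv, le_div_iff₀' (by positivity)]
  exact hA t

lemma one_add_im_sq_le (u : ℂ) : 1 + u.im ^ 2 ≤ (1 + ‖u‖) ^ 2 := by
  have h1 : u.im ^ 2 ≤ ‖u‖ ^ 2 := by
    rw [← sq_abs]; exact pow_le_pow_left₀ (abs_nonneg _) (Complex.abs_im_le_norm u) 2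
  nlinarith [norm_nonneg u]

lemma one_add_im_sq_mul_norm_mul_le {u p q : ℂ} {N : ℕ} {A c W : ℝ}
    (hp : (1 + ‖u‖) ^ (N + 2) * ‖p‖ ≤ A) (hq : ‖q‖ ≤ c * (1 + ‖u‖) ^ N * W) (hcW : 0 ≤ c * W) :
    (1 + u.im ^ 2) * ‖p * q‖ ≤ A * (c * W) := by
  rw [norm_mul]
  calc _ ≤ (1 + ‖u‖) ^ 2 * (‖p‖ * (c * (1 + ‖u‖) ^ N * W)) := by
        gcongr; exact one_add_im_sq_le u
    _ = ((1 + ‖u‖) ^ (N + 2) * ‖p‖) * (c * W) := by ring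
    _ ≤ _ := by gcongr

lemma one_add_norm_pow_mul_le {u : ℂ} {N : ℕ} {b A₀ A₁ : ℝ} (hb : 0 ≤ b)
    (h0 : ‖u‖ ^ 0 * b ≤ A₀) (h1 : ‖u‖ ^ N * b ≤ A₁) :
    (1 + ‖u‖) ^ N * b ≤ 2 ^ (N - 1) * (A₀ + A₁) := by
  calc _ ≤ (2 ^ (N - 1) * (1 ^ N + ‖u‖ ^ N)) * b := by
        gcongr; exact add_pow_le zero_le_one (norm_nonneg u) N
    _ = 2 ^ (N - 1) * (‖u‖ ^ 0 * b + ‖u‖ ^ N * b) := by ring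
    _ ≤ _ := by gcongr

lemma IsHalfLineSchwartz.exists_one_add_norm_pow_mul_mellin_le {Φ : ℝ → ℂ}
    (hΦ : IsHalfLineSchwartz Φ) (N : ℕ) {σ₁ σ₂ : ℝ} (hσ : 0 < σ₁) :
    ∃ A : ℝ, 0 ≤ A ∧ ∀ u : ℂ, σ₁ ≤ u.re → u.re ≤ σ₂ → (1 + ‖u‖) ^ N * ‖mellin Φ u‖ ≤ A := by
  obtain ⟨A₀, h0⟩ := hΦ.exists_norm_mellin_le 0 (σ₂ := σ₂) hσ
  obtain ⟨A₁, h1⟩ := hΦ.exists_norm_mellin_le N (σ₂ := σ₂) hσ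
  exact ⟨max (2 ^ (N - 1) * (A₀ + A₁)) 0, le_max_right _ _, fun u hu hu' =>
    (one_add_norm_pow_mul_le (norm_nonneg _) (h0 u hu hu') (h1 u hu hu')).trans (le_max_left _ _)⟩

lemma norm_exp_sq_le {u : ℂ} {δ : ℝ} (hu : |u.re| ≤ δ) :
    (1 + u.im ^ 2) * ‖Complex.exp (u ^ 2)‖ ≤ Real.exp (δ ^ 2) := by
  have hre : (u ^ 2).re = u.re ^ 2 - u.im ^ 2 := by simp [sq]
  have h1 : u.re ^ 2 ≤ δ ^ 2 := by
    rw [← sq_abs]; exact pow_le_pow_left₀ (abs_nonneg _) hu 2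
  rw [Complex.norm_exp, hre]
  calc _ ≤ Real.exp (u.im ^ 2) * Real.exp (u.re ^ 2 - u.im ^ 2) := by
        gcongr
        linarith [Real.add_one_le_exp (u.im ^ 2)]
    _ = Real.exp (u.re ^ 2) := by rw [← Real.exp_add]; congr 1; ring
    _ ≤ _ := Real.exp_le_exp.2 h1

/-- The integral of `F(u)/u` along `Re u = δ` is controlled by `F(0)` and by `F` on `Re u = -δ`.
The contour is moved across the simple pole after subtracting `F(0) e^{u²}/u`, whose integrals along
the two lines are absolute constants. -/
lemma norm_integral_div_le_of_shift {δ : ℝ} (hδ : 0 < δ) :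
    ∃ E : ℝ, ∀ (F : ℂ → ℂ) (B W : ℝ), DifferentiableOn ℂ F {u : ℂ | -(2 * δ) < u.re} →
      (∀ u : ℂ, |u.re| ≤ δ → (1 + u.im ^ 2) * ‖F u‖ ≤ B) →
      (∀ u : ℂ, u.re = -δ → (1 + u.im ^ 2) * ‖F u‖ ≤ W) → ‖F 0‖ ≤ W →
      ‖∫ t : ℝ, F (δ + t * Complex.I) / (δ + t * Complex.I)‖ ≤ E * W := by
  let X : ℂ → ℂ := fun u => Complex.exp (u ^ 2) / u
  have hline : ∀ σ : ℝ, σ = δ ∨ σ = -δ → ∀ t : ℝ,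
      (σ : ℂ) + t * Complex.I ≠ 0 ∧ δ ≤ ‖(σ : ℂ) + t * Complex.I‖ ∧
        |((σ : ℂ) + t * Complex.I).re| ≤ δ := by
    intro σ hσ t
    have habs : |σ| = δ := by
      rcases hσ with rfl | rfl
      · exact abs_of_pos hδ
      · rw [abs_neg, abs_of_pos hδ]
    have h1 : |((σ : ℂ) + t * Complex.I).re| = δ := by simpa using habs
    have h2 := Complex.abs_re_le_norm ((σ : ℂ) + t * Complex.I)
    rw [h1] at h2
    exact ⟨norm_pos_iff.1 (hδ.trans_le h2), h2, h1.le⟩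
  -- quadratic decay survives division by `u` on the two lines
  have hdiv : ∀ σ : ℝ, σ = δ ∨ σ = -δ → ∀ (F : ℂ → ℂ) (b : ℝ),
      (∀ t : ℝ, (1 + t ^ 2) * ‖F (σ + t * Complex.I)‖ ≤ b) → ∀ t : ℝ,
      (1 + t ^ 2) * ‖F (σ + t * Complex.I) / (σ + t * Complex.I)‖ ≤ b / δ := by
    intro σ hσ F b h t
    obtain ⟨-, h2, -⟩ := hline σ hσ t
    have hb : 0 ≤ b := le_trans (by positivity) (h t)
    rw [norm_div, ← mul_div_assoc]
    exact div_le_div₀ hb (h t) hδ h2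
  have hX : ∀ σ : ℝ, σ = δ ∨ σ = -δ → Integrable fun t : ℝ => X (σ + t * Complex.I) := by
    intro σ hσ
    refine integrable_vertical ?_ (hdiv σ hσ (fun u => Complex.exp (u ^ 2)) (Real.exp (δ ^ 2))
      fun t => ?_)
    · refine Continuous.div (by fun_prop) (by fun_prop) fun t => (hline σ hσ t).1
    · simpa using norm_exp_sq_le (hline σ hσ t).2.2
  refine ⟨Real.pi / δ + ‖∫ t : ℝ, X ((-δ : ℝ) + t * Complex.I)‖ +
    ‖∫ t : ℝ, X (δ + t * Complex.I)‖, fun F B W hF hB hW hW0 => ?_⟩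
  have hWnn : 0 ≤ W := (norm_nonneg _).trans hW0
  have hopen : IsOpen {u : ℂ | -(2 * δ) < u.re} := isOpen_lt continuous_const Complex.continuous_re
  have h0mem : (0 : ℂ) ∈ {u : ℂ | -(2 * δ) < u.re} := by
    simpa using hδ
  let S : ℂ → ℂ := fun u => F u - F 0 * Complex.exp (u ^ 2)
  have hS0 : S 0 = 0 := by simp [S]
  have hS : DifferentiableOn ℂ S {u : ℂ | -(2 * δ) < u.re} :=
    hF.sub (Differentiable.differentiableOn (by fun_prop))
  have hT : DifferentiableOn ℂ (dslope S 0) {u : ℂ | -(2 * δ) < u.re} :=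
    (Complex.differentiableOn_dslope (hopen.mem_nhds h0mem)).2 hS
  have hTeq : ∀ u : ℂ, u ≠ 0 → dslope S 0 u = F u / u - F 0 * X u := fun u hu => by
    rw [dslope_of_ne _ hu, slope_def_field, hS0, sub_zero, sub_zero]
    simp only [S, X]; ring
  have hSb : ∀ u : ℂ, |u.re| ≤ δ → (1 + u.im ^ 2) * ‖S u‖ ≤ B + W * Real.exp (δ ^ 2) := by
    intro u hu
    calc _ ≤ (1 + u.im ^ 2) * (‖F u‖ + ‖F 0 * Complex.exp (u ^ 2)‖) := by
          gcongr; exact norm_sub_le _ _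
      _ = (1 + u.im ^ 2) * ‖F u‖ + ‖F 0‖ * ((1 + u.im ^ 2) * ‖Complex.exp (u ^ 2)‖) := by
          rw [norm_mul]; ring
      _ ≤ _ := add_le_add (hB u hu) (mul_le_mul hW0 (norm_exp_sq_le hu) (by positivity) hWnn)
  have hTb : ∃ K, ∀ u : ℂ, -δ ≤ u.re → u.re ≤ δ → (1 + u.im ^ 2) * ‖dslope S 0 u‖ ≤ K := by
    have hcpt : IsCompact (Set.Icc (-δ) δ ×ℂ Set.Icc (-1 : ℝ) 1) :=
      isCompact_Icc.reProdIm isCompact_Icc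
    obtain ⟨K₁, hK₁⟩ := hcpt.exists_bound_of_continuousOn
      (f := fun u => (1 + (u.im : ℂ) ^ 2) * dslope S 0 u) (by
        refine ContinuousOn.mul (by fun_prop) (hT.continuousOn.mono fun u hu => ?_)
        have h1 : -δ ≤ u.re := (Complex.mem_reProdIm.1 hu).1.1
        have : -(2 * δ) < u.re := by linarith
        exact this)
    refine ⟨max K₁ (B + W * Real.exp (δ ^ 2)), fun u h1 h2 => ?_⟩
    rcases le_or_gt |u.im| 1 with h | h
    · refine le_trans (le_of_eq ?_) ((hK₁ u (Complex.mem_reProdIm.2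
        ⟨⟨h1, h2⟩, abs_le.1 h⟩)).trans (le_max_left _ _))
      rw [norm_mul]
      congr 1
      rw [show (1 + (u.im : ℂ) ^ 2) = ((1 + u.im ^ 2 : ℝ) : ℂ) by push_cast; rfl,
        Complex.norm_real, Real.norm_of_nonneg (by positivity)]
    · refine le_trans ?_ ((hSb u (abs_le.2 ⟨h1, h2⟩)).trans (le_max_right _ _))
      have hu1 : 1 ≤ ‖u‖ := h.le.trans (Complex.abs_im_le_norm u)
      have hu0 : u ≠ 0 := norm_pos_iff.1 (by linarith)
      rw [dslope_of_ne _ hu0, slope_def_field, hS0, sub_zero, sub_zero, norm_div]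
      gcongr
      exact div_le_self (norm_nonneg _) hu1
  obtain ⟨K, hK⟩ := hTb
  have hshift := integral_vertical_eq (F := dslope S 0) (σ₁ := -δ) (σ₂ := δ) (K := K)
    (fun u h1 h2 => hT.differentiableAt (hopen.mem_nhds (by
      have : -(2 * δ) < u.re := by linarith
      exact this))) hK (by linarith)
  have hFint : ∀ σ : ℝ, σ = δ ∨ σ = -δ →
      Integrable fun t : ℝ => F (σ + t * Complex.I) / (σ + t * Complex.I) := by
    intro σ hσ
    refine integrable_vertical (F := fun u => F u / u) ?_ (hdiv σ hσ F B fun t => ?_)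
    · refine Continuous.div ?_ (by fun_prop) fun t => (hline σ hσ t).1
      refine hF.continuousOn.comp_continuous (by fun_prop) fun t => ?_
      have h3 := (abs_le.1 (hline σ hσ t).2.2).1
      have : -(2 * δ) < ((σ : ℂ) + t * Complex.I).re := by linarith
      exact this
    · simpa using hB _ (hline σ hσ t).2.2
  have hTint : ∀ σ : ℝ, σ = δ ∨ σ = -δ → ∫ t : ℝ, dslope S 0 (σ + t * Complex.I) =
      (∫ t : ℝ, F (σ + t * Complex.I) / (σ + t * Complex.I)) -
        F 0 * ∫ t : ℝ, X (σ + t * Complex.I) := by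
    intro σ hσ
    rw [← integral_const_mul, ← integral_sub (hFint σ hσ) ((hX σ hσ).const_mul _)]
    exact integral_congr_ae (.of_forall fun t => hTeq _ (hline σ hσ t).1)
  rw [hTint (-δ) (Or.inr rfl), hTint δ (Or.inl rfl)] at hshift
  have hmain : ∫ t : ℝ, F (δ + t * Complex.I) / (δ + t * Complex.I) =
      (∫ t : ℝ, F ((-δ : ℝ) + t * Complex.I) / ((-δ : ℝ) + t * Complex.I)) -
        F 0 * (∫ t : ℝ, X ((-δ : ℝ) + t * Complex.I)) + F 0 * ∫ t : ℝ, X (δ + t * Complex.I) := by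
    linear_combination -hshift
  have h1 := norm_integral_vertical_le (F := fun u => F u / u) (σ := -δ)
    (hdiv (-δ) (Or.inr rfl) F W fun t => by
      simpa using hW ((-δ : ℝ) + t * Complex.I) (by simp))
  rw [hmain]
  calc _ ≤ W / δ * Real.pi + W * ‖∫ t : ℝ, X ((-δ : ℝ) + t * Complex.I)‖ +
        W * ‖∫ t : ℝ, X (δ + t * Complex.I)‖ := by
        refine (norm_add_le _ _).trans (add_le_add ((norm_sub_le _ _).trans (add_le_add h1 ?_)) ?_)
        all_goals
          rw [norm_mul]
          gcongr
    _ = _ := by ring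

section

/-! ### The two-sided remainder -/

/-- `C^{-u}` times the sum over both edges `±1` of the remainders after `n` terms; its product with
the Mellin transform of `Φ` is integrated along vertical lines. -/
def twoSidedRem (γ : ℤˣ → ℕ → ℝ → ℂ) (a : ℂ) (n : ℕ) (C D : ℝ) (u : ℂ) : ℂ :=
  (C : ℂ) ^ (-u) * ∑ s : ℤˣ, e (((s : ℤ) : ℝ) * D) * edgeRem (γ s) a n (((s : ℤ) : ℝ) * D) u

variable {Φ : ℝ → ℂ} {γ : ℤˣ → ℕ → ℝ → ℂ} {R : ℝ} {a : ℂ}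

lemma exists_norm_twoSidedRem_le (hγ : ∀ s, IsJetOn (Set.Ici 0) (γ s)) (hR : 1 ≤ R)
    (hsupp : ∀ s j, ∀ y, R < y → γ s j y = 0) (n : ℕ) {σ₁ : ℝ} (σ₂ : ℝ) (hσ : -2 < a.re + σ₁) :
    ∃ (c : ℝ) (N : ℕ), 0 ≤ c ∧ ∀ u : ℂ, σ₁ ≤ u.re → u.re ≤ σ₂ → ∀ C D : ℝ, 0 < C → D ≠ 0 →
      ‖twoSidedRem γ a n C D u‖ ≤
        c * (1 + ‖u‖) ^ N * (|C ^ 2 * D| ^ (-(u.re / 2)) * |D| ^ (-((n : ℝ) + 1 + a.re / 2))) := by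
  have h1 := fun s => exists_norm_edgeRem_le (hγ s) hR (hsupp s) a n σ₂ hσ
  choose c N hc h using h1
  refine ⟨∑ s, c s, ∑ s, N s, Finset.sum_nonneg fun s _ => hc s, fun u hu1 hu2 C D hC hD => ?_⟩
  have hD0 : 0 < |D| := abs_pos.2 hD
  have hpow : |C ^ 2 * D| ^ (-(u.re / 2)) * |D| ^ (-((n : ℝ) + 1 + a.re / 2)) =
      C ^ (-u.re) * |D| ^ (-((a.re + u.re) / 2 + n + 1)) := by
    rw [abs_mul, abs_of_pos (by positivity), Real.mul_rpow (by positivity) hD0.le, mul_assoc,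
      ← Real.rpow_add hD0, ← Real.rpow_natCast C 2, ← Real.rpow_mul hC.le]
    congr 2
    · push_cast; ring
    · ring
  rw [twoSidedRem, norm_mul, Complex.norm_cpow_eq_rpow_re_of_pos hC, Complex.neg_re, hpow,
    mul_left_comm]
  refine mul_le_mul_of_nonneg_left ?_ (by positivity)
  rw [Finset.sum_mul, Finset.sum_mul]
  refine (norm_sum_le _ _).trans (Finset.sum_le_sum fun s _ => ?_)
  rw [norm_mul, norm_e, one_mul]
  have h2 := h s u hu1 hu2 (((s : ℤ) : ℝ) * D) (mul_ne_zero (units_cast_ne_zero s) hD)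
  rw [abs_mul, abs_units_cast, one_mul] at h2
  refine h2.trans ?_
  have h3 : N s ≤ ∑ s, N s := Finset.single_le_sum (fun _ _ => Nat.zero_le _) (Finset.mem_univ s)
  have h4 : 1 ≤ 1 + ‖u‖ := by linarith [norm_nonneg u]
  have := hc s
  gcongr

lemma differentiableAt_twoSidedRem (hγ : ∀ s, IsJetOn (Set.Ici 0) (γ s)) (hR : 1 ≤ R)
    (hsupp : ∀ s j, ∀ y, R < y → γ s j y = 0) (n : ℕ) {C D : ℝ} (hC : 0 < C) (hD : D ≠ 0) {u : ℂ}
    (hu : -2 < a.re + u.re) : DifferentiableAt ℂ (twoSidedRem γ a n C D) u := by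
  unfold twoSidedRem
  refine DifferentiableAt.fun_mul (DifferentiableAt.const_cpow (by fun_prop)
    (Or.inl (by exact_mod_cast hC.ne'))) (DifferentiableAt.fun_sum fun s _ => ?_)
  exact (differentiableAt_edgeRem (hγ s) hR (hsupp s) a n
    (mul_ne_zero (units_cast_ne_zero s) hD) hu).const_mul _

lemma exists_quadratic_decay (hΦ : IsHalfLineSchwartz Φ) (hγ : ∀ s, IsJetOn (Set.Ici 0) (γ s))
    (hR : 1 ≤ R) (hsupp : ∀ s j, ∀ y, R < y → γ s j y = 0) (ha : -2 < a.re) (n : ℕ) {σ₁ : ℝ}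
    (σ₂ : ℝ) (hσ : 0 < σ₁) {C D : ℝ} (hC : 0 < C) (hD : D ≠ 0) :
    ∃ K : ℝ, ∀ u : ℂ, σ₁ ≤ u.re → u.re ≤ σ₂ →
      (1 + u.im ^ 2) * ‖mellin Φ u * twoSidedRem γ a n C D u‖ ≤ K := by
  obtain ⟨c, N, hc, h⟩ := exists_norm_twoSidedRem_le (a := a) hγ hR hsupp n σ₂
    (show -2 < a.re + σ₁ by linarith)
  obtain ⟨A, hA0, hA⟩ := hΦ.exists_one_add_norm_pow_mul_mellin_le (N + 2) (σ₂ := σ₂) hσ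
  have hX : 0 < |C ^ 2 * D| := abs_pos.2 (mul_ne_zero (by positivity) hD)
  refine ⟨A * (c * ((|C ^ 2 * D| ^ (-(σ₂ / 2)) + |C ^ 2 * D| ^ (-(σ₁ / 2))) *
    |D| ^ (-((n : ℝ) + 1 + a.re / 2)))), fun u h1 h2 => ?_⟩
  refine one_add_im_sq_mul_norm_mul_le (hA u h1 h2) ((h u h1 h2 C D hC hD).trans ?_)
    (by positivity)
  gcongr
  exact rpow_le_rpow_add_rpow hX (by linarith) (by linarith)

/-- The vertical integral of the remainder does not depend on the line. -/
lemma integral_twoSidedRem_eq (hΦ : IsHalfLineSchwartz Φ) (hγ : ∀ s, IsJetOn (Set.Ici 0) (γ s))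
    (hR : 1 ≤ R) (hsupp : ∀ s j, ∀ y, R < y → γ s j y = 0) (ha : -2 < a.re) (n : ℕ) {C D τ τ' : ℝ}
    (hC : 0 < C) (hD : D ≠ 0) (hτ : 0 < τ) (hτ' : 0 < τ') :
    ∫ t : ℝ, mellin Φ (τ + t * Complex.I) * twoSidedRem γ a n C D (τ + t * Complex.I) =
      ∫ t : ℝ, mellin Φ (τ' + t * Complex.I) * twoSidedRem γ a n C D (τ' + t * Complex.I) := by
  wlog hle : τ ≤ τ' generalizing τ τ'
  · exact (this hτ' hτ (le_of_not_ge hle)).symm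
  obtain ⟨K, hK⟩ := exists_quadratic_decay hΦ hγ hR hsupp ha n τ' hτ hC hD
  refine integral_vertical_eq (F := fun u => mellin Φ u * twoSidedRem γ a n C D u)
    (fun u h1 _ => ?_) hK hle
  have hu : 0 < u.re := hτ.trans_le h1
  exact (hΦ.differentiableAt_mellin hu).fun_mul
    (differentiableAt_twoSidedRem hγ hR hsupp n hC hD (by linarith))

/-- The estimate of the remainder integral for `τ₁ > 0`: move to `Re u = 2τ₁`. -/
lemma exists_norm_integral_twoSidedRem_le (hΦ : IsHalfLineSchwartz Φ)
    (hγ : ∀ s, IsJetOn (Set.Ici 0) (γ s)) (hR : 1 ≤ R)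
    (hsupp : ∀ s j, ∀ y, R < y → γ s j y = 0) (ha : -2 < a.re) (n : ℕ) {τ₁ : ℝ} (hτ₁ : 0 < τ₁) :
    ∃ K : ℝ, ∀ τ C D : ℝ, 0 < τ → 0 < C → D ≠ 0 →
      ‖∫ t : ℝ, mellin Φ (τ + t * Complex.I) * twoSidedRem γ a n C D (τ + t * Complex.I)‖ ≤
        K * (|C ^ 2 * D| ^ (-τ₁) * |D| ^ (-((n : ℝ) + 1 + a.re / 2))) := by
  have h2τ : 0 < 2 * τ₁ := by positivity
  obtain ⟨c, N, hc, h⟩ := exists_norm_twoSidedRem_le (a := a) hγ hR hsupp n (2 * τ₁)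
    (show -2 < a.re + 2 * τ₁ by linarith)
  obtain ⟨A, hA0, hA⟩ := hΦ.exists_one_add_norm_pow_mul_mellin_le (N + 2) (σ₂ := 2 * τ₁) h2τ
  refine ⟨A * c * Real.pi, fun τ C D hτ hC hD => ?_⟩
  rw [integral_twoSidedRem_eq hΦ hγ hR hsupp ha n hC hD hτ h2τ]
  refine (norm_integral_vertical_le (F := fun u => mellin Φ u * twoSidedRem γ a n C D u)
    (A := A * (c * (|C ^ 2 * D| ^ (-τ₁) * |D| ^ (-((n : ℝ) + 1 + a.re / 2))))) fun t => ?_).trans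
    (le_of_eq (by ring))
  have hre : (((2 * τ₁ : ℝ) : ℂ) + t * Complex.I).re = 2 * τ₁ := by simp
  have him : (((2 * τ₁ : ℝ) : ℂ) + t * Complex.I).im = t := by simp
  have h1 := h _ hre.ge hre.le C D hC hD
  rw [hre, show 2 * τ₁ / 2 = τ₁ by ring] at h1
  have h2 := one_add_im_sq_mul_norm_mul_le (hA _ hre.ge hre.le) h1 (by positivity)
  rwa [him] at h2

/-- The estimate of the remainder integral for `τ₁ = 0` when `Φ̃` has at most a simple pole at `0`:
move to `Re u = δ` if `C²|D| ≥ 1`, and across the pole to `Re u = -δ` if `C²|D| < 1`. -/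
lemma exists_norm_integral_twoSidedRem_le_of_pole (hΦ : IsHalfLineSchwartz Φ)
    (hpole : MellinAtMostSimplePole Φ)
    (hγ : ∀ s, IsJetOn (Set.Ici 0) (γ s)) (hR : 1 ≤ R)
    (hsupp : ∀ s j, ∀ y, R < y → γ s j y = 0) (ha : -2 < a.re) (n : ℕ) :
    ∃ K : ℝ, ∀ τ C D : ℝ, 0 < τ → 0 < C → D ≠ 0 →
      ‖∫ t : ℝ, mellin Φ (τ + t * Complex.I) * twoSidedRem γ a n C D (τ + t * Complex.I)‖ ≤
        K * |D| ^ (-((n : ℝ) + 1 + a.re / 2)) := by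
  obtain ⟨ε, G, hε, hGd, hG, hGb⟩ := hpole
  obtain ⟨δ, hδ0, hδε, hδa, hδ1⟩ : ∃ δ : ℝ, 0 < δ ∧ 2 * δ ≤ ε ∧ 2 * δ < a.re + 2 ∧ δ ≤ 1 := by
    refine ⟨min (ε / 2) (min ((a.re + 2) / 4) 1), ?_, ?_, ?_, ?_⟩
    · exact lt_min (by positivity) (lt_min (by linarith) one_pos)
    · linarith [min_le_left (ε / 2) (min ((a.re + 2) / 4) 1)]
    · have h1 := min_le_right (ε / 2) (min ((a.re + 2) / 4) 1)
      have h2 := min_le_left ((a.re + 2) / 4) 1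
      linarith
    · exact (min_le_right _ _).trans (min_le_right _ _)
  obtain ⟨c, N, hc, h⟩ := exists_norm_twoSidedRem_le (a := a) (σ₁ := -δ) hγ hR hsupp n δ
    (by linarith)
  obtain ⟨A, hA0, hA⟩ : ∃ A : ℝ, 0 ≤ A ∧ ∀ u : ℂ, -δ ≤ u.re → u.re ≤ δ →
      (1 + ‖u‖) ^ (N + 2) * ‖G u‖ ≤ A := by
    obtain ⟨A₀, h0⟩ := hGb 0
    obtain ⟨A₁, h1⟩ := hGb (N + 2)
    refine ⟨max (2 ^ (N + 2 - 1) * (A₀ + A₁)) 0, le_max_right _ _, fun u hu hu' => ?_⟩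
    exact (one_add_norm_pow_mul_le (norm_nonneg _) (h0 u (by linarith) (by linarith))
      (h1 u (by linarith) (by linarith))).trans (le_max_left _ _)
  obtain ⟨E, hE⟩ := norm_integral_div_le_of_shift hδ0
  refine ⟨max (A * c / δ * Real.pi) (E * (A * c)), fun τ C D hτ hC hD => ?_⟩
  rw [integral_twoSidedRem_eq hΦ hγ hR hsupp ha n hC hD hτ hδ0]
  have hX : 0 < |C ^ 2 * D| := abs_pos.2 (mul_ne_zero (by positivity) hD)
  set X := |C ^ 2 * D|
  obtain ⟨Q, hQ⟩ : ∃ Q, Q = |D| ^ (-((n : ℝ) + 1 + a.re / 2)) := ⟨_, rfl⟩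
  have hQ0 : 0 ≤ Q := by rw [hQ]; positivity
  rw [← hQ]
  let F : ℂ → ℂ := fun u => G u * twoSidedRem γ a n C D u
  have hFb : ∀ u : ℂ, |u.re| ≤ δ → (1 + u.im ^ 2) * ‖F u‖ ≤ A * (c * (X ^ (-(u.re / 2)) * Q)) := by
    intro u hu
    have hu' := abs_le.1 hu
    rw [hQ]
    exact one_add_im_sq_mul_norm_mul_le (hA u hu'.1 hu'.2) (h u hu'.1 hu'.2 C D hC hD)
      (by positivity)
  have hline : ∀ t : ℝ, ((δ : ℂ) + t * Complex.I).re = δ := fun t => by simp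
  have hne : ∀ t : ℝ, (δ : ℂ) + t * Complex.I ≠ 0 := fun t h0 => by
    have := hline t
    rw [h0, Complex.zero_re] at this
    linarith
  have hFeq : ∀ t : ℝ, mellin Φ (δ + t * Complex.I) * twoSidedRem γ a n C D (δ + t * Complex.I) =
      F (δ + t * Complex.I) / (δ + t * Complex.I) := fun t => by
    simp only [F]
    rw [hG _ (by rw [hline]; exact hδ0), mul_assoc, mul_div_cancel_left₀ _ (hne t)]
  simp only [hFeq]
  rcases le_or_gt 1 X with hX1 | hX1
  · refine (norm_integral_vertical_le (F := fun u => F u / u) (A := A * (c * Q) / δ)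
      fun t => ?_).trans ?_
    · have h1 := hFb (δ + t * Complex.I) (by rw [hline, abs_of_pos hδ0])
      rw [hline] at h1
      have h2 : δ ≤ ‖(δ : ℂ) + t * Complex.I‖ := by
        have := Complex.abs_re_le_norm ((δ : ℂ) + t * Complex.I)
        rwa [hline, abs_of_pos hδ0] at this
      have h3 : X ^ (-(δ / 2)) ≤ 1 := Real.rpow_le_one_of_one_le_of_nonpos hX1 (by linarith)
      rw [norm_div, ← mul_div_assoc]
      refine div_le_div₀ (by positivity) (le_trans (le_of_eq (by simp)) (h1.trans ?_)) hδ0 h2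
      gcongr
      exact mul_le_of_le_one_left hQ0 h3
    · calc _ = A * c / δ * Real.pi * Q := by ring
        _ ≤ _ := by gcongr; exact le_max_left _ _
  · refine (hE F (A * (c * ((X ^ (-(δ / 2)) + X ^ (-(-δ / 2))) * Q))) (A * (c * Q)) ?_ ?_ ?_
      ?_).trans ?_
    · intro u hu
      have hu' : -(2 * δ) < u.re := hu
      have hopen : IsOpen {u : ℂ | -ε < u.re} := isOpen_lt continuous_const Complex.continuous_re
      have hmem : u ∈ {u : ℂ | -ε < u.re} := by
        have : -ε < u.re := by linarith
        exact this
      exact ((hGd.differentiableAt (hopen.mem_nhds hmem)).fun_mul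
        (differentiableAt_twoSidedRem hγ hR hsupp n hC hD
          (by linarith))).differentiableWithinAt
    · intro u hu
      refine (hFb u hu).trans ?_
      have hu' := abs_le.1 hu
      gcongr
      exact rpow_le_rpow_add_rpow hX (by linarith) (by linarith)
    · intro u hu
      refine (hFb u (by rw [hu, abs_neg, abs_of_pos hδ0])).trans ?_
      rw [hu]
      have h3 : X ^ (-(-δ / 2)) ≤ 1 := Real.rpow_le_one hX.le hX1.le (by linarith)
      gcongr
      exact mul_le_of_le_one_left hQ0 h3
    · simpa using hFb 0 (by simpa using hδ0.le)
    · calc _ = E * (A * c) * Q := by ring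
        _ ≤ _ := by gcongr; exact le_max_right _ _

/-! ### Comparison with the transforms -/

lemma edgeRem_sub_succ (γ : ℕ → ℝ → ℂ) (a : ℂ) (m : ℕ) (d : ℝ) (u : ℂ) :
    edgeRem γ a m d u - edgeRem γ a (m + 1) d u =
      edgeJet γ u m 0 / m.factorial * (Complex.Gamma ((a + u) / 2 + m + 1) *
          (-(2 * Real.pi * Complex.I * d)) ^ (-((a + u) / 2 + m + 1))) := by
  rw [edgeRem, edgeRem, laplaceRem, laplaceRem, Finset.sum_range_succ]
  ring

lemma integrable_mellin_mul_edgeRem (hΦ : IsHalfLineSchwartz Φ) {γ : ℕ → ℝ → ℂ}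
    (hγ : IsJetOn (Set.Ici 0) γ) (hR : 1 ≤ R) (hsupp : ∀ j, ∀ y, R < y → γ j y = 0)
    (ha : -2 < a.re) (n : ℕ) {C d τ : ℝ} (hC : 0 < C) (hd : d ≠ 0) (hτ : 0 < τ) :
    Integrable fun t : ℝ => mellin Φ (τ + t * Complex.I) *
      (C : ℂ) ^ (-((τ : ℂ) + t * Complex.I)) * edgeRem γ a n d (τ + t * Complex.I) := by
  have hre : ∀ t : ℝ, ((τ : ℂ) + t * Complex.I).re = τ := fun t => by simp
  have him : ∀ t : ℝ, ((τ : ℂ) + t * Complex.I).im = t := fun t => by simp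
  obtain ⟨c, N, hc, h⟩ := exists_norm_edgeRem_le hγ hR hsupp a n τ
    (show -2 < a.re + τ by linarith)
  obtain ⟨A, hA0, hA⟩ := hΦ.exists_one_add_norm_pow_mul_mellin_le (N + 2) (σ₂ := τ) hτ
  refine integrable_vertical
    (F := fun u => mellin Φ u * (C : ℂ) ^ (-u) * edgeRem γ a n d u)
    (A := A * (c * (C ^ (-τ) * |d| ^ (-((a.re + τ) / 2 + n + 1))))) ?_ fun t => ?_
  · refine ((hΦ.continuous_mellin_vertical hτ).mul ?_).mul
      (continuous_iff_continuousAt.2 fun t => ?_)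
    · exact Continuous.const_cpow (by fun_prop) (Or.inl (by exact_mod_cast hC.ne'))
    · exact ContinuousAt.comp (f := fun t : ℝ => (τ : ℂ) + t * Complex.I)
        (differentiableAt_edgeRem hγ hR hsupp a n hd (by rw [hre]; linarith)).continuousAt
        (by fun_prop)
  · have h1 := h _ (hre t).ge (hre t).le d hd
    rw [hre] at h1
    have h2 := one_add_im_sq_mul_norm_mul_le (hA _ (hre t).ge (hre t).le)
      (q := (C : ℂ) ^ (-((τ : ℂ) + t * Complex.I)) * edgeRem γ a n d (τ + t * Complex.I))
      (c := c) (W := C ^ (-τ) * |d| ^ (-((a.re + τ) / 2 + n + 1))) (by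
        rw [norm_mul, Complex.norm_cpow_eq_rpow_re_of_pos hC, Complex.neg_re, hre]
        calc _ ≤ C ^ (-τ) * (c * (1 + ‖(τ : ℂ) + t * Complex.I‖) ^ N *
              |d| ^ (-((a.re + τ) / 2 + n + 1))) := by gcongr
          _ = _ := by ring) (by positivity)
    rw [him] at h2
    simpa only [mul_assoc] using h2

end

end SingularFourier

end

open SingularFourier
theorem theoremA
    (a : ℂ) (ha : -2 < a.re)
    (Φ : ℝ → ℂ) (hΦ : IsHalfLineSchwartz Φ)
    (h₁ h : ℝ → ℂ)
    (hsupp : HasCompactSupport h₁)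
    (hsmooth : ContDiffOn ℝ ∞ h₁ {x : ℝ | 1 ≤ |x|})
    (hh : ∀ x : ℝ, h x = ((|1 - x ^ 2| : ℝ) : ℂ) ^ (a / 2) * h₁ x)
    (c : ℤˣ → ℕ → ℂ)
    (hc : ∀ s : ℤˣ,
      HasAsympExpansion (𝓝[<] 0) (fun x : ℝ => h (((s : ℤ) : ℝ) * (1 - x))) (a / 2) (c s)) :
    (∀ u : ℂ, 0 < u.re → MellinConvergent Φ u) ∧
    (∀ (m : ℕ) (s : ℤˣ) (τ x : ℝ), 0 < τ → x ≠ 0 →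
      Integrable fun t : ℝ => transformIntegrand a (c s) m Φ x ((τ : ℂ) + t * Complex.I)) ∧
    (∀ C D : ℝ, 0 < C → D ≠ 0 →
      IntegrableOn (fun x : ℝ => h x * Φ (C / √(x ^ 2 - 1)) * e (x * D)) {x : ℝ | 1 < |x|}) ∧
    ∀ (M : ℕ) (τ₁ : ℝ), (0 < τ₁ ∨ (τ₁ = 0 ∧ MellinAtMostSimplePole Φ)) →
      ∃ K : ℝ, ∀ τ C D : ℝ, 0 < τ → 0 < C → D ≠ 0 →
        ‖(∫ x in {x : ℝ | 1 < |x|}, h x * Φ (C / √(x ^ 2 - 1)) * e (x * D)) -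
            ∑ m ∈ Finset.range (M + 1), ∑ s : ℤˣ,
              e (((s : ℤ) : ℝ) * D) * (-1) ^ m *
                transform a (c s) m τ Φ (((s : ℤ) : ℝ) * (C ^ 2 * D)) /
                ((((s : ℤ) : ℝ) * D : ℝ) : ℂ) ^ ((m : ℂ) + 1 + a / 2)‖
          ≤ K * (|C ^ 2 * D| ^ (-τ₁) * |D| ^ (-((M : ℝ) + 2 + a.re / 2))) := by
  obtain ⟨R, hR, hR0⟩ := exists_sideJet_eq_zero a hsupp hsmooth
  have hγ := isJetOn_sideJet a hsmooth
  have hcoef := fun s => sideJet_zero_eq hsupp hsmooth hh (hc s)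
  have hterm : ∀ (m : ℕ) (s : ℤˣ) (C d : ℝ), 0 < C → d ≠ 0 → ∀ u : ℂ,
      (-1) ^ m * transformIntegrand a (c s) m Φ (C ^ 2 * d) u / (d : ℂ) ^ ((m : ℂ) + 1 + a / 2) =
        mellin Φ u * (C : ℂ) ^ (-u) * edgeRem (sideJet a h₁ s) a m d u -
          mellin Φ u * (C : ℂ) ^ (-u) * edgeRem (sideJet a h₁ s) a (m + 1) d u := by
    intro m s C d hC hd u
    rw [transformIntegrand_eq (hcoef s) Φ m hC hd u, ← edgeRem_sub_succ, mul_sub]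
  have hpow0 : ∀ (m : ℕ) (d : ℝ), d ≠ 0 → (d : ℂ) ^ ((m : ℂ) + 1 + a / 2) ≠ 0 := fun m d hd =>
    (Complex.cpow_ne_zero_iff_of_exponent_ne_zero (fun h0 => by
      have h1 := congrArg Complex.re h0
      simp at h1
      have : (0 : ℝ) ≤ m := m.cast_nonneg
      linarith)).2 (by exact_mod_cast hd)
  have hsideint : ∀ (s : ℤˣ) (C D y : ℝ), 0 < y →
      h (((s : ℤ) : ℝ) * (1 + y)) * Φ (C / √((((s : ℤ) : ℝ) * (1 + y)) ^ 2 - 1)) *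
        e (((s : ℤ) : ℝ) * (1 + y) * D) =
      e (((s : ℤ) : ℝ) * D) * ((y : ℂ) ^ (a / 2) * sideJet a h₁ s 0 y *
        Φ (C / √(y * (2 + y))) *
        Complex.exp (-(-(2 * Real.pi * Complex.I * (((s : ℤ) : ℝ) * D : ℝ)) * y))) := by
    intro s C D y hy
    have h2 : (((s : ℤ) : ℝ) * (1 + y)) ^ 2 - 1 = y * (2 + y) := by
      rw [mul_pow, ← sq_abs ((s : ℤ) : ℝ), abs_units_cast]; ring
    rw [apply_edge_eq hh s hy, h2, e_units_mul_add]
    ring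
  have hint : ∀ C D : ℝ, 0 < C → D ≠ 0 →
      IntegrableOn (fun x : ℝ => h x * Φ (C / √(x ^ 2 - 1)) * e (x * D)) {x : ℝ | 1 < |x|} := by
    intro C D hC hD
    refine integrableOn_one_lt_abs fun s => ?_
    refine (integrableOn_congr_fun (fun y hy => hsideint s C D y hy) measurableSet_Ioi).2 ?_
    exact (integrableOn_side hΦ (hγ s) hR (hR0 s) ha hC _).const_mul _
  refine ⟨fun u hu => hΦ.mellinConvergent hu, fun m s τ x hτ hx => ?_, hint, fun M τ₁ hτ₁ => ?_⟩
  · have h1 := (integrable_mellin_mul_edgeRem hΦ (hγ s) hR (hR0 s) ha m one_pos hx hτ).sub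
      (integrable_mellin_mul_edgeRem hΦ (hγ s) hR (hR0 s) ha (m + 1) one_pos hx hτ)
    refine (h1.const_mul ((-1) ^ m * (x : ℂ) ^ ((m : ℂ) + 1 + a / 2))).congr
      (.of_forall fun t => ?_)
    have h2 := hterm m s 1 x one_pos hx (τ + t * Complex.I)
    rw [one_pow, one_mul] at h2
    simp only [Pi.sub_apply]
    rw [← h2]
    have h3 := hpow0 m x hx
    have h4 : ((-1 : ℂ)) ^ m * (-1) ^ m = 1 := by rw [← mul_pow]; simp
    rw [mul_div_assoc', mul_right_comm, mul_div_assoc, div_self h3, mul_one, ← mul_assoc, h4,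
      one_mul]
  have hdiff : ∀ τ C D : ℝ, 0 < τ → 0 < C → D ≠ 0 →
      (∫ x in {x : ℝ | 1 < |x|}, h x * Φ (C / √(x ^ 2 - 1)) * e (x * D)) -
        ∑ m ∈ Finset.range (M + 1), ∑ s : ℤˣ,
          e (((s : ℤ) : ℝ) * D) * (-1) ^ m *
            transform a (c s) m τ Φ (((s : ℤ) : ℝ) * (C ^ 2 * D)) /
            ((((s : ℤ) : ℝ) * D : ℝ) : ℂ) ^ ((m : ℂ) + 1 + a / 2) =
      1 / (2 * Real.pi) * ∫ t : ℝ, mellin Φ (τ + t * Complex.I) *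
        twoSidedRem (sideJet a h₁) a (M + 1) C D (τ + t * Complex.I) := by
    intro τ C D hτ hC hD
    have hd : ∀ s : ℤˣ, ((s : ℤ) : ℝ) * D ≠ 0 := fun s => mul_ne_zero (units_cast_ne_zero s) hD
    -- `V n s` is the vertical integral of the one-sided remainder after `n` terms
    obtain ⟨V, hV⟩ : ∃ V : ℕ → ℤˣ → ℂ, ∀ n s, V n s = ∫ t : ℝ, mellin Φ (τ + t * Complex.I) *
        (C : ℂ) ^ (-((τ : ℂ) + t * Complex.I)) *
          edgeRem (sideJet a h₁ s) a n (((s : ℤ) : ℝ) * D) (τ + t * Complex.I) :=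
      ⟨_, fun _ _ => rfl⟩
    have hVint := fun (n : ℕ) (s : ℤˣ) =>
      integrable_mellin_mul_edgeRem hΦ (hγ s) hR (hR0 s) ha n hC (hd s) hτ
    have e1 : (∫ x in {x : ℝ | 1 < |x|}, h x * Φ (C / √(x ^ 2 - 1)) * e (x * D)) =
        ∑ s : ℤˣ, 1 / (2 * Real.pi) * (e (((s : ℤ) : ℝ) * D) * V 0 s) := by
      rw [setIntegral_one_lt_abs (hint C D hC hD)]
      refine Finset.sum_congr rfl fun s _ => ?_
      rw [setIntegral_congr_fun measurableSet_Ioi fun y hy => hsideint s C D y hy,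
        integral_const_mul, integral_side_eq hΦ (hγ s) hR (hR0 s) ha hτ hC, hV]
      ring
    have e2 : ∀ (m : ℕ) (s : ℤˣ), e (((s : ℤ) : ℝ) * D) * (-1) ^ m *
        transform a (c s) m τ Φ (((s : ℤ) : ℝ) * (C ^ 2 * D)) /
          ((((s : ℤ) : ℝ) * D : ℝ) : ℂ) ^ ((m : ℂ) + 1 + a / 2) =
        1 / (2 * Real.pi) * (e (((s : ℤ) : ℝ) * D) * (V m s - V (m + 1) s)) := by
      intro m s
      have h1 : V m s - V (m + 1) s = (-1) ^ m *
          (∫ t : ℝ, transformIntegrand a (c s) m Φ (C ^ 2 * (((s : ℤ) : ℝ) * D))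
            (τ + t * Complex.I)) / ((((s : ℤ) : ℝ) * D : ℝ) : ℂ) ^ ((m : ℂ) + 1 + a / 2) := by
        rw [hV, hV, ← integral_sub (hVint m s) (hVint (m + 1) s), ← integral_const_mul,
          ← integral_div]
        exact integral_congr_ae (.of_forall fun t => (hterm m s C _ hC (hd s) _).symm)
      rw [h1, transform, integral_mul_const,
        show ((s : ℤ) : ℝ) * (C ^ 2 * D) = C ^ 2 * (((s : ℤ) : ℝ) * D) by ring]
      have hπ : (Real.pi : ℂ) ≠ 0 := by exact_mod_cast Real.pi_ne_zero
      field_simp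
    have e3 : ∫ t : ℝ, mellin Φ (τ + t * Complex.I) *
        twoSidedRem (sideJet a h₁) a (M + 1) C D (τ + t * Complex.I) =
        ∑ s : ℤˣ, e (((s : ℤ) : ℝ) * D) * V (M + 1) s := by
      simp only [hV, ← integral_const_mul]
      rw [← integral_finsetSum _ fun s _ => (hVint (M + 1) s).const_mul _]
      refine integral_congr_ae (.of_forall fun t => ?_)
      simp only [twoSidedRem, Finset.mul_sum]
      exact Finset.sum_congr rfl fun s _ => by ring
    rw [e1, e3, Finset.sum_comm, ← Finset.sum_sub_distrib, Finset.mul_sum]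
    refine Finset.sum_congr rfl fun s _ => ?_
    simp only [e2]
    rw [← Finset.mul_sum, ← Finset.mul_sum, Finset.sum_range_sub' (fun m => V m s)]
    ring
  have hfin : ∃ K : ℝ, ∀ τ C D : ℝ, 0 < τ → 0 < C → D ≠ 0 →
      ‖∫ t : ℝ, mellin Φ (τ + t * Complex.I) *
        twoSidedRem (sideJet a h₁) a (M + 1) C D (τ + t * Complex.I)‖ ≤
        K * (|C ^ 2 * D| ^ (-τ₁) * |D| ^ (-(((M + 1 : ℕ) : ℝ) + 1 + a.re / 2))) := by
    rcases hτ₁ with hpos | ⟨rfl, hpole⟩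
    · exact exists_norm_integral_twoSidedRem_le hΦ hγ hR hR0 ha (M + 1) hpos
    · simpa using exists_norm_integral_twoSidedRem_le_of_pole hΦ hpole hγ hR hR0 ha (M + 1)
  obtain ⟨K, hK⟩ := hfin
  refine ⟨1 / (2 * Real.pi) * K, fun τ C D hτ hC hD => ?_⟩
  rw [hdiff τ C D hτ hC hD, norm_mul, mul_assoc]
  have h2π : ‖(1 / (2 * Real.pi) : ℂ)‖ = 1 / (2 * Real.pi) := by
    simp [abs_of_pos Real.pi_pos]
  rw [h2π]
  have h3 := hK τ C D hτ hC hD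
  rw [show (((M + 1 : ℕ) : ℝ) + 1 + a.re / 2) = (M : ℝ) + 2 + a.re / 2 by push_cast; ring] at h3
  have hpi := Real.pi_pos
  gcongr
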